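/- **Setting.** Let $\kappa\ge 3$ and $0\le\lambda\le\kappa-2$ be integers. A *$(\kappa,\lambda)$-graphical sequence* is a sequence $\mathcal G=((\gamma_i,\alpha_i,\beta_i))_{i=1}^{g+1}$ of distinct triples of non-negative integers such that: for $1\le i\le g$, $\beta_i,\gamma_i\ge1$, $\gamma_i+\alpha_i+\beta_i=\kappa$ and $\alpha_i\ge\max\{\lambda+1-\beta_i,\lambda+1-\gamma_i\}$; $(\gamma_1,\alpha_1,\beta_1)=(1,\lambda,\kappa-\lambda-1)$; $\beta_i\ge\beta_{i+1}$ $(1\le i\le g-1)$ and $\gamma_i\le\gamma_{i+1}$ $(1\le i\le g)$; $\beta_{g+1}=0$ and $\gamma_{g+1}+\alpha_{g+1}=\kappa$. A *$(\kappa,\lambda)$-quadruple* $(\mathcal G,\Delta;L,\ell)$ consists of such a $\mathcal G$, a subsequence $\Delta$ of $\mathcal G$, identified with its set of indices, with $1\in\Delta\subseteq\{1,\dots,g\}$, and functions $\ell:\{1,\dots,g+1\}\to\mathbb Z_{>0}$, $L:\{1,\dots,g+1\}\setminus\Delta\to\mathbb Z_{>0}$ with $\ell(g+1)=1$ and $L(i)=\ell(i)$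 for all $i\notin\Delta$. Put $s(i)=1+\sum_{j<i}\ell(j)$ and $D=s(g+1)$. Let $(c_0,a_0,b_0)=(0,0,\kappa)$ and $(c_m,a_m,b_m)=(\gamma_i,\alpha_i,\beta_i)$ for $s(i)\le m<s(i)+\ell(i)$, $1\le i\le g+1$. Let $L_1$ be the $(D+1)\times(D+1)$ tridiagonal matrix with rows $(\dots,c_m,a_m,b_m,\dots)$, $0\le m\le D$. Let $v_0=1$, $v_1=x$, $xv_m=b_{m-1}v_{m-1}+a_mv_m+c_{m+1}v_{m+1}$ $(1\le m\le D-1)$, and put $\kappa_m=v_m(\kappa)$, $u_m=v_m/\kappa_m$ $(0\le m\le D)$. *Well-placed intervals.* For $1\le i\le g$ let $\mathfrak R_i=\alpha_i+2\sqrt{\beta_i\gamma_i}$, $\mathfrak L_i=\alpha_i-2\sqrt{\beta_i\gamma_i}$ (the guide points), $I_i=(\mathfrak L_i,\mathfrak R_i)$ and $\mathfrak R_{\max}=\max_{1\le i\le g}\mathfrak R_i$. For a closed interval $\mathcal I=[\mathcal I_{\min},\mathcal I_{\max}]\subseteq(\mathfrak R_1,\mathfrak R_{\max})$ of positive length let $\mathfrak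 a$ and $\mathfrak b$ be the minimum and the maximum of $\{2\le i\le g:\mathcal I_{\max}<\mathfrak R_i\}$, let $\mathfrak c=\min(\{2\le i\le g:\mathcal I_{\max}<\mathfrak L_i\}\cup\{g+1\})$ and $\mathfrak d=\max(\{2\le i\le g:\mathcal I_{\max}<\mathfrak L_i\}\cup\{\mathfrak c\})$. Such an interval $\mathcal I$ is *well-placed* if $\mathcal I\subseteq I_{\mathfrak a}$ and, for $1\le j\le g$, $\mathcal I\cap I_j\ne\emptyset$ implies $\mathcal I\subseteq I_j$. If $\mathfrak c\le g$, let $\mathrm{Len}(\mathcal I)=\sum\ell(i)$ over those $1\le i\le g$ with $\mathfrak a\le i<\mathfrak c$ or $\mathfrak d<i\le\mathfrak b$, and let $\mathrm{Gap}(\mathcal I)=\sum_{\mathfrak c\le i\le\mathfrak d}\ell(i)$. If $\mathfrak c=g+1$, let $\mathrm{Len}(\mathcal I)=\sum_{\mathfrak a\le i\le\mathfrak b}\ell(i)$ and $\mathrm{Gap}(\mathcal I)=0$. For $1\le i\le g$ let $\rho_i(\theta)$ be the root of larger absolute value of $\beta_iz^2+(\alpha_i-\theta)z+\gamma_i=0$.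 *The bad set.* For $p\in\Delta$ let $q$ be the next larger element of $\Delta$, or $q=g+1$ if there is none, and let $N=\sum_{p<i<q}L(i)$. Let $w_1,\dots,w_N$ be the list of indices $q-1,q-2,\dots,p+1$ in this order, each $i$ repeated $L(i)$ times. Let $f_1,f_2,g_1,g_2$ be the polynomials in $\theta$ such that every solution of $\beta_{w_j}y_{j-1}+(\alpha_{w_j}-\theta)y_j+\gamma_{w_j}y_{j+1}=0$ $(1\le j\le N)$ satisfies $y_N=f_1(\theta)y_1+g_1(\theta)y_0$ and $y_{N+1}=f_2(\theta)y_1+g_2(\theta)y_0$ (for $N=0$: $f_1=g_2=0$, $f_2=g_1=1$). Let $X_i(\theta)$ be the set of roots of $\gamma_iz^2+(\alpha_i-\theta)z+\beta_i=0$, and put $$F_p(\theta)=\prod_{\xi\in X_p(\theta)}\bigl((\theta-\alpha_{g+1})(f_1\xi-f_2)+\gamma_{g+1}(g_1\xi-g_2)\bigr)\ \text{ if } q=g+1,$$ $$F_p(\theta)=\prod_{\xi\in X_p(\theta),\,\chi\in X_q(\theta)}\bigl((f_1\xi-f_2)\chi+g_1\xi-g_2\bigr)\ \text{ if } q\le g.$$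 Let $\mathcal B(\mathcal G,\Delta,L)$ be the set of all $\theta$ for which there is $p\in\Delta$ with $\beta_p\le\gamma_p$, $\theta\in[\mathfrak R_p,\mathfrak R_{\max}]$ and $F_p(\theta)=0$. **Theorem.** Let $(\mathcal G,\Delta;L,\ell)$ be a $(\kappa,\lambda)$-quadruple and let $\mathcal I$ be a well-placed interval with respect to $\mathcal G$ that contains none of the guide points $\mathfrak R_i,\mathfrak L_i$ $(1\le i\le g)$ and satisfies $\mathcal I\cap\mathcal B(\mathcal G,\Delta,L)=\emptyset$. Then there exist positive constants $C_1=C_1(\kappa,\mathcal G,\mathcal I)$, $F=F(\kappa,\mathcal G,\Delta,L,\mathcal I)$ and $C_2=C_2(\kappa,\mathcal G,\Delta,L,\mathcal I)$ (none depending on $\ell$) such that, if $\ell(i)>F$ for all $i\in\Delta$, then for every $\theta\in\mathcal I$ $$C_1\Bigl(\frac1{9\kappa^4}\Bigr)^{\mathrm{Gap}(\mathcal I)}\mathrm{Len}(\mathcal I)\prod_{i=1}^{\mathfrak a-1}\Bigl(\frac{\beta_i}{\gamma_i}\rho_i(\theta)^2\Bigr)^{\ell(i)}\le\sum_{i=0}^{D}\kappa_iu_i(\theta)^2,$$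 and for every $\theta\in\mathcal I$ which is an eigenvalue of $L_1$ (and for every $\theta\in\mathcal I$ whatsoever if $\mathfrak b=g$) $$\sum_{i=0}^{D}\kappa_iu_i(\theta)^2\le C_2\,(9\kappa^4)^{\mathrm{Gap}(\mathcal I)}\,\mathrm{Len}(\mathcal I)\prod_{i=1}^{\mathfrak a-1}\Bigl(\frac{\beta_i}{\gamma_i}\rho_i(\theta)^2\Bigr)^{\ell(i)}.$$ -/

import Mathlib

noncomputable section

/-! ### Graphical sequences

All sequences are indexed from `1`, as functions on `ℕ` of which only the values at
the indices `1, …, g + 1` matter. -/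

/-- The set `V_{κ,lam}` of admissible triples `(γ, α, β)`; the condition
`α ≥ max {lam + 1 - β, lam + 1 - γ}` (over the integers) is written additively. -/
def admissibleTriples (κ lam : ℕ) : Set (ℕ × ℕ × ℕ) :=
  {t | 1 ≤ t.2.2 ∧ 1 ≤ t.1 ∧ t.1 + t.2.1 + t.2.2 = κ ∧
    lam + 1 ≤ t.2.1 + t.2.2 ∧ lam + 1 ≤ t.2.1 + t.1}

/-- A `(κ, lam)`-graphical sequence `((γ i, α i, β i))`, `1 ≤ i ≤ g + 1`. -/
structure GraphicalSeq (κ lam : ℕ) where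
  g : ℕ
  γ : ℕ → ℕ
  α : ℕ → ℕ
  β : ℕ → ℕ
  distinct : Set.InjOn (fun i => (γ i, α i, β i)) (Set.Icc 1 (g + 1))
  G0 : ∀ i, 1 ≤ i → i ≤ g → (γ i, α i, β i) ∈ admissibleTriples κ lam
  G1 : (γ 1, α 1, β 1) = (1, lam, κ - lam - 1)
  G2_β : ∀ i, 1 ≤ i → i + 1 ≤ g → β (i + 1) ≤ β i
  G2_γ : ∀ i, 1 ≤ i → i ≤ g → γ i ≤ γ (i + 1)
  G3 : β (g + 1) = 0 ∧ γ (g + 1) + α (g + 1) = κ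

/-! ### Roots of the auxiliary quadratic equations -/

/-- The root of larger absolute value of `p z² + q z + r = 0`, when `p > 0` and both
roots are real (the only case in which it is used). -/
def bigRoot (p q r : ℝ) : ℝ :=
  if q ≤ 0 then (-q + √(q ^ 2 - 4 * p * r)) / (2 * p)
  else (-q - √(q ^ 2 - 4 * p * r)) / (2 * p)

/-- The other root of `p z² + q z + r = 0`, when `p > 0` and both roots are real. -/
def smallRoot (p q r : ℝ) : ℝ :=
  if q ≤ 0 then (-q - √(q ^ 2 - 4 * p * r)) / (2 * p)
  else (-q + √(q ^ 2 - 4 * p * r)) / (2 * p)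

theorem quadratic_eq_mul_roots {p q r : ℝ} (hp : 0 < p) (h : 0 ≤ q ^ 2 - 4 * p * r) (z : ℝ) :
    p * z ^ 2 + q * z + r = p * (z - bigRoot p q r) * (z - smallRoot p q r) := by
  have hs := Real.sq_sqrt h
  unfold bigRoot smallRoot
  generalize √(q ^ 2 - 4 * p * r) = d at hs ⊢
  split_ifs <;> field_simp <;> linear_combination hs

theorem abs_smallRoot_le_abs_bigRoot (p q r : ℝ) :
    |smallRoot p q r| ≤ |bigRoot p q r| := by
  have hs := Real.sqrt_nonneg (q ^ 2 - 4 * p * r)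
  unfold bigRoot smallRoot
  split_ifs with hq <;>
  · rw [abs_div, abs_div]
    refine div_le_div_of_nonneg_right ?_ (abs_nonneg _)
    rw [← sq_le_sq]
    nlinarith

namespace GraphicalSeq

variable {κ lam : ℕ}

/-! ### The tridiagonal sequence and its tridiagonal matrix -/

/-- `s(i) = 1 + ∑_{1 ≤ j < i} ℓ(j)`. -/
def s (ℓ : ℕ → ℕ) (i : ℕ) : ℕ := 1 + ∑ j ∈ Finset.Ico 1 i, ℓ j

/-- The diameter `D = s(g + 1)`. -/
def diam (G : GraphicalSeq κ lam) (ℓ : ℕ → ℕ) : ℕ := s ℓ (G.g + 1)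

/-- The index `i` of the block `s(i), …, s(i) + ℓ(i) - 1` which contains `m`,
for `1 ≤ m ≤ D`. -/
def block (G : GraphicalSeq κ lam) (ℓ : ℕ → ℕ) (m : ℕ) : ℕ :=
  ((Finset.Icc 1 (G.g + 1)).filter fun i => s ℓ i ≤ m).card

theorem block_eq (G : GraphicalSeq κ lam) (ℓ : ℕ → ℕ) {i j : ℕ} (hi : 1 ≤ i) (hig : i ≤ G.g + 1) (hj : j < ℓ i) :
    block G ℓ (s ℓ i + j) = i := by
  have hmono : ∀ a b, a ≤ b → s ℓ a ≤ s ℓ b := fun a b hab =>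
    Nat.add_le_add_left
      (Finset.sum_le_sum_of_subset (Finset.Ico_subset_Ico_right hab)) 1
  have hsucc : s ℓ (i + 1) = s ℓ i + ℓ i := by
    unfold s
    rw [Finset.sum_Ico_succ_top hi]
    ring
  have hset : ((Finset.Icc 1 (G.g + 1)).filter fun k => s ℓ k ≤ s ℓ i + j) = Finset.Icc 1 i := by
    ext k
    simp only [Finset.mem_filter, Finset.mem_Icc]
    constructor
    · rintro ⟨⟨h1, _⟩, h3⟩
      refine ⟨h1, ?_⟩
      by_contra hk
      have := hmono (i + 1) k (by omega)
      omega
    · rintro ⟨h1, h2⟩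
      exact ⟨⟨h1, by omega⟩, (hmono k i h2).trans (Nat.le_add_right _ _)⟩
  unfold block
  rw [hset]
  simp

/-- `c_m` for `0 ≤ m ≤ D`, with `c_0 = 0`. -/
def c (G : GraphicalSeq κ lam) (ℓ : ℕ → ℕ) (m : ℕ) : ℝ :=
  if m = 0 then 0 else (G.γ (block G ℓ m) : ℝ)

/-- `a_m` for `0 ≤ m ≤ D`, with `a_0 = 0`. -/
def a (G : GraphicalSeq κ lam) (ℓ : ℕ → ℕ) (m : ℕ) : ℝ :=
  if m = 0 then 0 else (G.α (block G ℓ m) : ℝ)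

/-- `b_m` for `0 ≤ m ≤ D`, with `b_0 = κ`. -/
def b (G : GraphicalSeq κ lam) (ℓ : ℕ → ℕ) (m : ℕ) : ℝ :=
  if m = 0 then (κ : ℝ) else (G.β (block G ℓ m) : ℝ)

/-- The tridiagonal matrix `L₁` whose `i`-th row is `(…, c_i, a_i, b_i, …)`. -/
def tridiagMatrix (G : GraphicalSeq κ lam) (ℓ : ℕ → ℕ) :
    Matrix (Fin (G.diam ℓ + 1)) (Fin (G.diam ℓ + 1)) ℝ :=
  Matrix.of fun i j =>
    if (j : ℕ) + 1 = i then G.c ℓ i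
    else if (j : ℕ) = i then G.a ℓ i
    else if (j : ℕ) = i + 1 then G.b ℓ i
    else 0

/-- The eigenvalues of the tridiagonal sequence. -/
def eigenvalues (G : GraphicalSeq κ lam) (ℓ : ℕ → ℕ) : Set ℝ :=
  {θ | Module.End.HasEigenvalue (Matrix.toLin' (G.tridiagMatrix ℓ)) θ}

/-- The polynomials `v_i`, with `v_0 = 1`, `v_1 = x` and
`x v_i = b_{i-1} v_{i-1} + a_i v_i + c_{i+1} v_{i+1}`. -/
def v (G : GraphicalSeq κ lam) (ℓ : ℕ → ℕ) : ℕ → Polynomial ℝ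
  | 0 => 1
  | 1 => Polynomial.X
  | i + 2 => Polynomial.C (G.c ℓ (i + 2))⁻¹ *
      ((Polynomial.X - Polynomial.C (G.a ℓ (i + 1))) * v G ℓ (i + 1)
        - Polynomial.C (G.b ℓ i) * v G ℓ i)

/-- `κ_i = v_i(κ)`. -/
def kap (G : GraphicalSeq κ lam) (ℓ : ℕ → ℕ) (i : ℕ) : ℝ := (G.v ℓ i).eval (κ : ℝ)

/-- The standard sequence `u_i(x) = v_i(x) / κ_i`. -/
def u (G : GraphicalSeq κ lam) (ℓ : ℕ → ℕ) (i : ℕ) (x : ℝ) : ℝ :=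
  (G.v ℓ i).eval x / G.kap ℓ i

/-! ### Guide points and well-placed intervals

The closed interval `[lo, hi]` is given by its end points. -/

/-- The right guide point `R_i`. -/
def R (G : GraphicalSeq κ lam) (i : ℕ) : ℝ := G.α i + 2 * √((G.β i : ℝ) * G.γ i)

/-- The left guide point `L_i`. -/
def Lft (G : GraphicalSeq κ lam) (i : ℕ) : ℝ := G.α i - 2 * √((G.β i : ℝ) * G.γ i)

/-- `R_max = max {R_i : 1 ≤ i ≤ g}`. -/
def Rmax (G : GraphicalSeq κ lam) : ℝ := sSup (G.R '' Set.Icc 1 G.g)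

/-- The guide interval `I_i = (L_i, R_i)`. -/
def guide (G : GraphicalSeq κ lam) (i : ℕ) : Set ℝ := Set.Ioo (G.Lft i) (G.R i)

/-- `min {2 ≤ i ≤ g : hi < R_i}`. -/
def fa (G : GraphicalSeq κ lam) (hi : ℝ) : ℕ := sInf {i | 2 ≤ i ∧ i ≤ G.g ∧ hi < G.R i}

/-- `max {2 ≤ i ≤ g : hi < R_i}`. -/
def fb (G : GraphicalSeq κ lam) (hi : ℝ) : ℕ := sSup {i | 2 ≤ i ∧ i ≤ G.g ∧ hi < G.R i}

/-- `min ({2 ≤ i ≤ g : hi < L_i} ∪ {g + 1})`. -/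
def fc (G : GraphicalSeq κ lam) (hi : ℝ) : ℕ :=
  sInf ({i | 2 ≤ i ∧ i ≤ G.g ∧ hi < G.Lft i} ∪ {G.g + 1})

/-- `max ({2 ≤ i ≤ g : hi < L_i} ∪ {fc})`. -/
def fd (G : GraphicalSeq κ lam) (hi : ℝ) : ℕ :=
  sSup ({i | 2 ≤ i ∧ i ≤ G.g ∧ hi < G.Lft i} ∪ {G.fc hi})

/-- The interval `[lo, hi]` is well-placed with respect to `G`. -/
structure WellPlaced (G : GraphicalSeq κ lam) (lo hi : ℝ) : Prop where
  pos_length : lo < hi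
  W1 : Set.Icc lo hi ⊆ Set.Ioo (G.R 1) G.Rmax
  W2 : ∀ j, 1 ≤ j → j ≤ G.g → (Set.Icc lo hi ∩ G.guide j).Nonempty → Set.Icc lo hi ⊆ G.guide j
  W3 : Set.Icc lo hi ⊆ G.guide (G.fa hi)

/-- The index set over which `Len` is summed. -/
def lenSet (G : GraphicalSeq κ lam) (hi : ℝ) : Finset ℕ :=
  if G.fc hi ≤ G.g then
    (Finset.Icc 1 G.g).filter fun i =>
      (G.fa hi ≤ i ∧ i < G.fc hi) ∨ (G.fd hi < i ∧ i ≤ G.fb hi)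
  else (Finset.Icc 1 G.g).filter fun i => G.fa hi ≤ i ∧ i ≤ G.fb hi

/-- `Len` of an interval with right end point `hi`. -/
def Len (G : GraphicalSeq κ lam) (ℓ : ℕ → ℕ) (hi : ℝ) : ℕ := ∑ j ∈ G.lenSet hi, ℓ j

/-- `Gap` of an interval with right end point `hi`. -/
def Gap (G : GraphicalSeq κ lam) (ℓ : ℕ → ℕ) (hi : ℝ) : ℕ :=
  if G.fc hi ≤ G.g then ∑ j ∈ Finset.Icc (G.fc hi) (G.fd hi), ℓ j else 0

/-! ### Quadruples and the bad set

The subsequence `Δ` of `G` is given by the set of its indices. -/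

/-- `(G, Δ; L, ℓ)` is a `(κ, lam)`-quadruple. -/
structure IsQuadruple (G : GraphicalSeq κ lam) (Δ : Finset ℕ) (L ℓ : ℕ → ℕ) : Prop where
  subset : Δ ⊆ Finset.Icc 1 G.g
  one_mem : 1 ∈ Δ
  ℓ_pos : ∀ i, 1 ≤ i → i ≤ G.g + 1 → 1 ≤ ℓ i
  ℓ_last : ℓ (G.g + 1) = 1
  L_pos : ∀ i, 1 ≤ i → i ≤ G.g + 1 → i ∉ Δ → 1 ≤ L i
  L_eq : ∀ i, 1 ≤ i → i ≤ G.g + 1 → i ∉ Δ → L i = ℓ i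

/-- The index in `Δ` that follows `p`, or `g + 1` if there is none. -/
def next (G : GraphicalSeq κ lam) (Δ : Finset ℕ) (p : ℕ) : ℕ :=
  sInf ({j | j ∈ Δ ∧ p < j} ∪ {G.g + 1})

/-- The word `w = (w_1, …, w_N)` of indices `q-1, …, q-1, q-2, …, p+1`, where `q` follows `p`
in `Δ` and where each index `i` strictly between `p` and `q` is repeated `L i` times. -/
def word (G : GraphicalSeq κ lam) (Δ : Finset ℕ) (L : ℕ → ℕ) (p : ℕ) : List ℕ :=
  ((List.range (G.next Δ p - 1 - p)).map fun t =>
    List.replicate (L (G.next Δ p - 1 - t)) (G.next Δ p - 1 - t)).flatten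

/-- One step `(v_{j-1}, v_j) ↦ (v_j, v_{j+1})` of the recurrence
`β_i v_{j-1} + (α_i - x) v_j + γ_i v_{j+1} = 0`. -/
def step (G : GraphicalSeq κ lam) (V : Polynomial ℝ × Polynomial ℝ) (i : ℕ) :
    Polynomial ℝ × Polynomial ℝ :=
  (V.2, Polynomial.C (G.γ i : ℝ)⁻¹ *
    ((Polynomial.X - Polynomial.C (G.α i : ℝ)) * V.2 - Polynomial.C (G.β i : ℝ) * V.1))

/-- The pair `(f₁, f₂)`: the coefficients of `v_1` in `v_N` and in `v_{N+1}`. -/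
def fpair (G : GraphicalSeq κ lam) (Δ : Finset ℕ) (L : ℕ → ℕ) (p : ℕ) :
    Polynomial ℝ × Polynomial ℝ := (G.word Δ L p).foldl G.step (0, 1)

/-- The pair `(g₁, g₂)`: the coefficients of `v_0` in `v_N` and in `v_{N+1}`. -/
def gpair (G : GraphicalSeq κ lam) (Δ : Finset ℕ) (L : ℕ → ℕ) (p : ℕ) :
    Polynomial ℝ × Polynomial ℝ := (G.word Δ L p).foldl G.step (1, 0)

/-- The two roots `x, y` of `γ_i z² + (α_i - θ) z + β_i = 0`. -/
def xyRoots (G : GraphicalSeq κ lam) (i : ℕ) (θ : ℝ) : Finset ℝ :=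
  {bigRoot (G.γ i) (G.α i - θ) (G.β i), smallRoot (G.γ i) (G.α i - θ) (G.β i)}

/-- The function `F` attached to the index `p` of `Δ`. -/
def badFun (G : GraphicalSeq κ lam) (Δ : Finset ℕ) (L : ℕ → ℕ) (p : ℕ) (θ : ℝ) : ℝ :=
  let f₁ := (G.fpair Δ L p).1.eval θ
  let f₂ := (G.fpair Δ L p).2.eval θ
  let g₁ := (G.gpair Δ L p).1.eval θ
  let g₂ := (G.gpair Δ L p).2.eval θ
  if G.next Δ p = G.g + 1 then
    ∏ ξ ∈ G.xyRoots p θ,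
      ((θ - G.α (G.g + 1)) * (f₁ * ξ - f₂) + G.γ (G.g + 1) * (g₁ * ξ - g₂))
  else
    ∏ ξ ∈ G.xyRoots p θ, ∏ χ ∈ G.xyRoots (G.next Δ p) θ,
      ((f₁ * ξ - f₂) * χ + g₁ * ξ - g₂)

/-- The bad set `B(G, Δ, L)`. -/
def badSet (G : GraphicalSeq κ lam) (Δ : Finset ℕ) (L : ℕ → ℕ) : Set ℝ :=
  ⋃ p ∈ {p | p ∈ Δ ∧ G.β p ≤ G.γ p}, {θ | θ ∈ Set.Icc (G.R p) G.Rmax ∧ G.badFun Δ L p θ = 0}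

/-! ### The quantities in the estimate -/

/-- `ρ_i(x)`, the root of larger absolute value of `β_i z² + (α_i - x) z + γ_i = 0`. -/
def rho (G : GraphicalSeq κ lam) (i : ℕ) (x : ℝ) : ℝ :=
  bigRoot (G.β i) (G.α i - x) (G.γ i)

/-- `∏_{1 ≤ i < fa} ((β_i / γ_i) ρ_i(θ)²)^{ℓ(i)}`. -/
def headProd (G : GraphicalSeq κ lam) (ℓ : ℕ → ℕ) (hi θ : ℝ) : ℝ :=
  ∏ i ∈ Finset.Ico 1 (G.fa hi), ((G.β i : ℝ) / G.γ i * G.rho i θ ^ 2) ^ ℓ i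

/-- `∑_{i=0}^{D} κ_i u_i(θ)²`. -/
def christoffelSum (G : GraphicalSeq κ lam) (ℓ : ℕ → ℕ) (θ : ℝ) : ℝ :=
  ∑ i ∈ Finset.range (G.diam ℓ + 1), G.kap ℓ i * G.u ℓ i θ ^ 2

end GraphicalSeq

end

/-! Write u_k = u_k(θ) and p_k = κ_{k+1} c_{k+1} = κ_k b_k. As 1 ≤ c_m ≤ κ, the sum in question is,
up to factors depending on κ, the term κ_0 u_0² = 1 plus the sum of p_k u_{k+1}² over 0 ≤ k < D.
Inside the i-th block u solves a recurrence with constant coefficients and p is geometric with ratio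
β_i / γ_i. The nature of the solutions depends on the sign of (α_i - θ)² - 4 β_i γ_i = (θ - R_i)(θ -
L_i), which stays away from 0 on the compact interval because no guide point lies in it
(`exists_discr_bound`). Moreover R_i = κ - (√β_i - √γ_i)² with √β_i - √γ_i decreasing in i, so the
R_i are unimodal and the blocks split into three ranges.

Head, i < 𝔞: here θ > R_i and β_i > γ_i. The ratio u_{k+1} / u_k stays at least ρ_i, since it starts
at θ / κ ≥ ρ_1 and ρ_i decreases with i. So p_k u_{k+1}² grows at least geometrically, and the head
contributes no more than a constant times its final value. Splitting off the smaller root gives the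
matching upper bound, so this final value is the product in the theorem up to constants
(`head_prod_le`, `le_head_prod`).

Middle, 𝔞 ≤ i ≤ 𝔟: where the roots are complex, p_k times a definite quadratic form in (u_k,
u_{k+1}) is constant on the block, so each index contributes about the same amount, whence `Len`.
Across the remaining blocks each step changes the weight of the pair by a factor of at most 9κ⁴ in
either direction, whence `Gap` (`middle_estimates`, `middle_sum_bounds`).

Tail, i > 𝔟: for an eigenvalue the last row of the matrix is a boundary condition which makes the
tail a head read backwards. The terms decay, and the tail is bounded by its initial pair
(`tail_sum_le`). If 𝔟 = g there is no such block and no boundary condition is needed. -/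

section

open Finset

/-! ### The larger root of a quadratic polynomial -/

theorem bigRoot_eq_of_nonpos {p q r : ℝ} (hq : q ≤ 0) :
    bigRoot p q r = (-q + √(q ^ 2 - 4 * p * r)) / (2 * p) := by
  simp [bigRoot, hq]

theorem quadratic_bigRoot {p q r : ℝ} (hp : 0 < p) (h : 0 ≤ q ^ 2 - 4 * p * r) :
    p * bigRoot p q r ^ 2 + q * bigRoot p q r + r = 0 := by
  rw [quadratic_eq_mul_roots hp h]
  ring

theorem neg_le_two_mul_bigRoot {p q r : ℝ} (hp : 0 < p) (hq : q ≤ 0) :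
    -q ≤ 2 * p * bigRoot p q r := by
  rw [bigRoot_eq_of_nonpos hq, mul_div_cancel₀ _ (by positivity)]
  linarith [Real.sqrt_nonneg (q ^ 2 - 4 * p * r)]

theorem bigRoot_pos {p q r : ℝ} (hp : 0 < p) (hq : q < 0) : 0 < bigRoot p q r := by
  have h := neg_le_two_mul_bigRoot (r := r) hp hq.le
  have h2 : 0 < 2 * p * bigRoot p q r := by linarith
  exact pos_of_mul_pos_right h2 (by positivity)

theorem le_bigRoot_of_quadratic_nonpos {p q r z : ℝ} (hp : 0 < p) (hq : q ≤ 0)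
    (hz : p * z ^ 2 + q * z + r ≤ 0) : z ≤ bigRoot p q r := by
  rw [bigRoot_eq_of_nonpos hq, le_div_iff₀ (by positivity)]
  have h : z * (2 * p) + q ≤ √(q ^ 2 - 4 * p * r) := by
    apply Real.le_sqrt_of_sq_le
    nlinarith
  linarith

/-- The product r / p of the roots is less than 1 and the value p + q + r at 1 is positive, so 1
neither separates the roots nor lies below both. -/
theorem bigRoot_lt_one {p q r : ℝ} (hp : 0 < p) (h : 0 ≤ q ^ 2 - 4 * p * r)
    (hrp : r < p) (h1 : 0 < p + q + r) : bigRoot p q r < 1 := by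
  have hx := quadratic_bigRoot hp h
  generalize bigRoot p q r = x at hx
  by_contra! hc
  have h2 : (x - 1) * (p * x - r) = -(p + q + r) * x := by linear_combination hx
  nlinarith [mul_nonneg (sub_nonneg.2 hc) (show 0 ≤ p * x - r by nlinarith), mul_pos h1 (show 0 < x by linarith)]

/-- If `p' ≤ p` and `r ≤ r'`, then `p z² + (t - p - r) z + r` is non-positive at the roots in `[0, 1]`
of `p' z² + (t - p' - r') z + r'`. -/
theorem quadratic_nonpos_of_root {p r p' r' t x : ℝ} (hpp : p' ≤ p) (hrr : r ≤ r') (hx0 : 0 ≤ x)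
    (hx1 : x ≤ 1) (hx : p' * x ^ 2 + (t - p' - r') * x + r' = 0) :
    p * x ^ 2 + (t - p - r) * x + r ≤ 0 := by
  -- The quadratic equals t x - (1 - x)(p x - r): on [0, 1] it decreases when p grows and r shrinks.
  nlinarith [mul_nonneg (sub_nonneg.2 hpp) (mul_nonneg hx0 (sub_nonneg.2 hx1)),
    mul_nonneg (sub_nonneg.2 hrr) (sub_nonneg.2 hx1)]

/-- A lower bound for `(p / r) z²`, where `z` is the larger root of `p z² + q z + r`. -/
theorem le_div_mul_bigRoot_sq {p q r k η : ℝ} (hp : 0 < p) (hpk : p ≤ k) (hr : 0 < r) (hrk : r ≤ k)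
    (hq : q ≤ 0) (hη : 0 ≤ η) (h : 4 * p * r + η ≤ q ^ 2) :
    1 + η / (4 * k ^ 2) ≤ p / r * bigRoot p q r ^ 2 := by
  have h1 := neg_le_two_mul_bigRoot (r := r) hp hq
  generalize bigRoot p q r = x at h1
  have h2 : q ^ 2 ≤ (2 * p * x) ^ 2 := by nlinarith
  have h3 : 1 + η / (4 * (p * r)) ≤ p / r * x ^ 2 := by
    have h5 : 1 + η / (4 * (p * r)) = (4 * p * r + η) / (4 * (p * r)) := by field_simp
    have h6 : p / r * x ^ 2 = (2 * p * x) ^ 2 / (4 * (p * r)) := by field_simp; ring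
    rw [h5, h6]
    gcongr
    exact h.trans h2
  have h4 : p * r ≤ k ^ 2 := by nlinarith
  have : η / (4 * k ^ 2) ≤ η / (4 * (p * r)) := by gcongr
  linarith

/-! ### One step of a three-term recurrence -/

/-- The difference u_{k+1} - x u_k is multiplied at each step by the other root c / (b x) ≥ 0, so it
keeps its sign. -/
theorem ratio_step {b e c x u₀ u₁ u₂ : ℝ} (hb : 0 < b) (hc : 0 ≤ c) (hx : 0 < x)
    (hroot : b * x ^ 2 + e * x + c = 0) (hrec : c * u₀ + e * u₁ + b * u₂ = 0)
    (h : x * u₀ ≤ u₁) : x * u₁ ≤ u₂ := by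
  have h1 : 0 ≤ b * x * (u₂ - x * u₁) := by
    have h2 : b * x * (u₂ - x * u₁) = c * (u₁ - x * u₀) := by
      linear_combination x * hrec - u₁ * hroot
    rw [h2]
    exact mul_nonneg hc (sub_nonneg.2 h)
  have := nonneg_of_mul_nonneg_right h1 (by positivity)
  linarith

/-- Source of the factor 9κ⁴: since 1 ≤ b, b u₂² ≤ (c u₀ + e u₁)² ≤ 2k²(u₀² + u₁²). The term b u₁²
adds at most k²(u₀² + u₁²), and 3k² ≤ 9k⁴. -/
theorem weight_step_le {b e c k u₀ u₁ u₂ : ℝ} (hb : 1 ≤ b) (hbk : b ≤ k) (hc : 1 ≤ c) (hck : c ≤ k)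
    (he : |e| ≤ k) (hrec : c * u₀ + e * u₁ + b * u₂ = 0) :
    b * (u₁ ^ 2 + u₂ ^ 2) ≤ 9 * k ^ 4 * (c * (u₀ ^ 2 + u₁ ^ 2)) := by
  have hk : 1 ≤ k := hb.trans hbk
  have he2 : e ^ 2 ≤ k ^ 2 := sq_le_sq' (by linarith [neg_abs_le e]) (by linarith [le_abs_self e])
  have hc2 : c ^ 2 ≤ k ^ 2 := by nlinarith
  have h1 : b * u₂ ^ 2 ≤ 2 * k ^ 2 * (u₀ ^ 2 + u₁ ^ 2) := by
    have h2 : b * u₂ ^ 2 ≤ (b * u₂) ^ 2 := by nlinarith [mul_nonneg (mul_nonneg (sub_nonneg.2 hb) (zero_le_one.trans hb)) (sq_nonneg u₂)]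
    have h3 : b * u₂ = -(c * u₀ + e * u₁) := by linarith
    rw [h3] at h2
    nlinarith [sq_nonneg (c * u₀ - e * u₁), mul_le_mul_of_nonneg_right he2 (sq_nonneg u₁),
      mul_le_mul_of_nonneg_right hc2 (sq_nonneg u₀)]
  have hk2 : k ≤ k ^ 2 := by nlinarith
  have hk4 : k ^ 2 ≤ k ^ 4 := pow_le_pow_right₀ hk (by norm_num)
  have h4 : b * u₁ ^ 2 ≤ k ^ 2 * (u₀ ^ 2 + u₁ ^ 2) := by
    nlinarith [mul_le_mul_of_nonneg_right (hbk.trans hk2) (sq_nonneg u₁), mul_nonneg (sq_nonneg k) (sq_nonneg u₀)]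
  have h5 : (0 : ℝ) ≤ u₀ ^ 2 + u₁ ^ 2 := by positivity
  calc b * (u₁ ^ 2 + u₂ ^ 2) ≤ 3 * k ^ 2 * (u₀ ^ 2 + u₁ ^ 2) := by linarith
    _ ≤ 9 * k ^ 4 * (1 * (u₀ ^ 2 + u₁ ^ 2)) := by nlinarith [mul_le_mul_of_nonneg_right hk4 h5]
    _ ≤ _ := by gcongr

/-- The quadratic form that is preserved, up to the factor `c / b`, by the recurrence
`c u₀ + e u₁ + b u₂ = 0`. -/
def energy (b e c u₀ u₁ : ℝ) : ℝ := b * u₁ ^ 2 + e * u₁ * u₀ + c * u₀ ^ 2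

theorem energy_step {b e c u₀ u₁ u₂ : ℝ} (hrec : c * u₀ + e * u₁ + b * u₂ = 0) :
    b * energy b e c u₁ u₂ = c * energy b e c u₀ u₁ := by
  unfold energy
  linear_combination (b * u₂ - c * u₀) * hrec

theorem energy_le {b e c k : ℝ} (hb : 0 ≤ b) (hbk : b ≤ k) (hck : c ≤ k) (he : |e| ≤ k) (u₀ u₁ : ℝ) :
    energy b e c u₀ u₁ ≤ 2 * k * (u₀ ^ 2 + u₁ ^ 2) := by
  unfold energy
  obtain ⟨h1, h2⟩ := abs_le.1 he
  nlinarith [mul_nonneg (sub_nonneg.2 h2) (sq_nonneg (u₀ + u₁)), mul_nonneg (neg_le_iff_add_nonneg.1 h1) (sq_nonneg (u₀ - u₁)),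
    mul_le_mul_of_nonneg_right hbk (sq_nonneg u₁), mul_le_mul_of_nonneg_right hck (sq_nonneg u₀)]

/-- Completing the square, 4b times the energy is (2b u₁ + e u₀)² + (4bc - e²) u₀², and similarly
with b and c exchanged. -/
theorem le_energy {b e c k η : ℝ} (hb : 0 < b) (hbk : b ≤ k) (hck : c ≤ k) (hη : 0 < η)
    (h : e ^ 2 + η ≤ 4 * b * c) (u₀ u₁ : ℝ) :
    η * (u₀ ^ 2 + u₁ ^ 2) ≤ 8 * k * energy b e c u₀ u₁ := by
  have h1 : η * u₀ ^ 2 ≤ 4 * b * energy b e c u₀ u₁ := by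
    unfold energy
    nlinarith [sq_nonneg (2 * b * u₁ + e * u₀), mul_le_mul_of_nonneg_right h (sq_nonneg u₀)]
  have h2 : η * u₁ ^ 2 ≤ 4 * c * energy b e c u₀ u₁ := by
    unfold energy
    nlinarith [sq_nonneg (2 * c * u₀ + e * u₁), mul_le_mul_of_nonneg_right h (sq_nonneg u₁)]
  have h3 : 0 ≤ energy b e c u₀ u₁ := by
    have : 0 ≤ 4 * b * energy b e c u₀ u₁ := le_trans (by positivity) h1
    exact nonneg_of_mul_nonneg_right this (by positivity)
  nlinarith [mul_le_mul_of_nonneg_right hbk h3, mul_le_mul_of_nonneg_right hck h3]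

/-! ### Sums of sequences with geometric growth -/

/-- Telescoping, since (q - 1) U k ≤ U (k + 1) - U k. -/
theorem sum_Ico_le_of_growth {U : ℕ → ℝ} {q : ℝ} {m n : ℕ} (hmn : m ≤ n) (h0 : 0 ≤ U m)
    (h : ∀ k, m ≤ k → k < n → q * U k ≤ U (k + 1)) :
    (q - 1) * ∑ k ∈ Ico m n, U k ≤ U n := by
  have h1 : (q - 1) * ∑ k ∈ Ico m n, U k ≤ ∑ k ∈ Ico m n, (U (k + 1) - U k) := by
    rw [mul_sum]
    refine sum_le_sum fun k hk => ?_
    rw [mem_Ico] at hk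
    linarith [h k hk.1 hk.2]
  rw [sum_Ico_sub _ hmn] at h1
  linarith

theorem sum_Ico_le_of_decay {V : ℕ → ℝ} {q : ℝ} {m n : ℕ} (hmn : m ≤ n) (h0 : 0 ≤ V n)
    (h : ∀ k, m ≤ k → k < n → q * V (k + 1) ≤ V k) :
    (q - 1) * ∑ k ∈ Ico m n, V (k + 1) ≤ V m := by
  have h1 : (q - 1) * ∑ k ∈ Ico m n, V (k + 1) ≤ -∑ k ∈ Ico m n, (V (k + 1) - V k) := by
    rw [mul_sum, ← sum_neg_distrib]
    refine sum_le_sum fun k hk => ?_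
    rw [mem_Ico] at hk
    linarith [h k hk.1 hk.2]
  rw [sum_Ico_sub _ hmn] at h1
  linarith

theorem le_pow_sub_mul {f : ℕ → ℝ} {C : ℝ} (hC : 0 ≤ C) {m n : ℕ} (hmn : m ≤ n)
    (h : ∀ k, m ≤ k → k < n → f (k + 1) ≤ C * f k) : f n ≤ C ^ (n - m) * f m := by
  induction n, hmn using Nat.le_induction with
  | base => simp
  | succ n hmn ih =>
    rw [Nat.succ_sub hmn, pow_succ']
    calc f (n + 1) ≤ C * f n := h n hmn (by omega)
      _ ≤ C * (C ^ (n - m) * f m) := by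
        gcongr
        exact ih fun k hk hk' => h k hk (by omega)
      _ = _ := by ring

theorem le_pow_sub_mul' {f : ℕ → ℝ} {C : ℝ} (hC : 0 ≤ C) {m n : ℕ} (hmn : m ≤ n)
    (h : ∀ k, m ≤ k → k < n → f k ≤ C * f (k + 1)) : f m ≤ C ^ (n - m) * f n := by
  induction n, hmn using Nat.le_induction with
  | base => simp
  | succ n hmn ih =>
    rw [Nat.succ_sub hmn, pow_succ]
    calc f m ≤ C ^ (n - m) * f n := ih fun k hk hk' => h k hk (by omega)
      _ ≤ C ^ (n - m) * (C * f (n + 1)) := by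
        gcongr
        exact h n hmn (by omega)
      _ = _ := by ring

theorem pow_sub_mul_le {f : ℕ → ℝ} {C : ℝ} (hC : 0 ≤ C) {m n : ℕ} (hmn : m ≤ n)
    (h : ∀ k, m ≤ k → k < n → C * f k ≤ f (k + 1)) : C ^ (n - m) * f m ≤ f n := by
  induction n, hmn using Nat.le_induction with
  | base => simp
  | succ n hmn ih =>
    rw [Nat.succ_sub hmn, pow_succ']
    calc C * C ^ (n - m) * f m = C * (C ^ (n - m) * f m) := by ring
      _ ≤ C * f n := by
        gcongr
        exact ih fun k hk hk' => h k hk (by omega)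
      _ ≤ _ := h n hmn (by omega)

/-! ### Solutions with constant coefficients and real characteristic roots -/

section ConstantCoefficients

variable {b e c x q : ℝ} {p u : ℕ → ℝ} {m n : ℕ}

theorem ratio_le_of_recur (hb : 0 < b) (hc : 0 ≤ c) (hx : 0 < x) (hroot : b * x ^ 2 + e * x + c = 0)
    (hrec : ∀ k, m ≤ k → k < n → c * u k + e * u (k + 1) + b * u (k + 2) = 0)
    (hu : 0 < u m) (hxu : x * u m ≤ u (m + 1)) {k : ℕ} (hmk : m ≤ k) (hkn : k ≤ n) :
    0 < u k ∧ x * u k ≤ u (k + 1) := by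
  induction k, hmk using Nat.le_induction with
  | base => exact ⟨hu, hxu⟩
  | succ k hmk ih =>
    obtain ⟨h1, h2⟩ := ih (by omega)
    exact ⟨(mul_pos hx h1).trans_le h2, ratio_step hb hc hx hroot (hrec k hmk (by omega)) h2⟩

/-- Reading the recurrence backwards exchanges b and c, so `ratio_step` applies to a root of c z² +
e z + b. -/
theorem ratio_le_of_recur' (hb : 0 ≤ b) (hc : 0 < c) (hx : 0 < x) (hroot : c * x ^ 2 + e * x + b = 0)
    (hrec : ∀ k, m ≤ k → k < n → c * u k + e * u (k + 1) + b * u (k + 2) = 0)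
    (hu : 0 ≤ u (n + 1)) (hxu : x * u (n + 1) ≤ u n) {k : ℕ} (hmk : m ≤ k) (hkn : k ≤ n) :
    0 ≤ u (k + 1) ∧ x * u (k + 1) ≤ u k := by
  induction hkn using Nat.decreasingInduction with
  | self => exact ⟨hu, hxu⟩
  | of_succ k hkn ih =>
    obtain ⟨h1, h2⟩ := ih (by omega)
    refine ⟨(mul_nonneg hx.le h1).trans h2, ratio_step hc hb hx hroot ?_ h2⟩
    linarith [hrec k hmk hkn]

theorem weighted_growth_step {k : ℕ} (hb : 0 < b) (hc : 0 < c) (hx : 0 < x) (hp : 0 < p k)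
    (hpk : p (k + 1) * c = p k * b) (hu : 0 ≤ u (k + 1)) (hxu : x * u (k + 1) ≤ u (k + 2)) :
    b / c * x ^ 2 * (p k * u (k + 1) ^ 2) ≤ p (k + 1) * u (k + 2) ^ 2 := by
  have h1 : p (k + 1) = p k * b / c := by field_simp; linarith
  have h2 : (x * u (k + 1)) ^ 2 ≤ u (k + 2) ^ 2 := by
    have := mul_nonneg hx.le hu
    gcongr
  calc _ = p k * b / c * (x * u (k + 1)) ^ 2 := by ring
    _ ≤ p k * b / c * u (k + 2) ^ 2 := by gcongr
    _ = _ := by rw [h1]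

/-- With y = c / (b x) the other root, u (k + 1) - y u k is multiplied by exactly x at each step. It
is comparable with u (k + 1): from y / x = c / (b x²) ≤ 1 / q follows y u k ≤ u (k + 1) / q. -/
theorem weighted_growth_le (hb : 0 < b) (hc : 0 < c) (hx : 0 < x) (hroot : b * x ^ 2 + e * x + c = 0)
    (hq : 1 < q) (hqx : q ≤ b / c * x ^ 2)
    (hp : ∀ k, m ≤ k → k ≤ n → 0 < p k)
    (hpk : ∀ k, m ≤ k → k < n → p (k + 1) * c = p k * b)
    (hrec : ∀ k, m ≤ k → k < n → c * u k + e * u (k + 1) + b * u (k + 2) = 0)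
    (hu : 0 < u m) (hxu : x * u m ≤ u (m + 1)) (hmn : m ≤ n) :
    (1 - 1 / q) ^ 2 * (p n * u (n + 1) ^ 2) ≤
      (b / c * x ^ 2) ^ (n - m) * (p m * u (m + 1) ^ 2) := by
  have hq0 : 0 < 1 - 1 / q := by
    rw [sub_pos, div_lt_one (by linarith)]
    exact hq
  set y := c / (b * x) with hy
  have hy0 : 0 < y := by positivity
  have hdu : ∀ k, m ≤ k → k ≤ n →
      (1 - 1 / q) * u (k + 1) ≤ u (k + 1) - y * u k ∧ u (k + 1) - y * u k ≤ u (k + 1) ∧ 0 < u (k + 1) := by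
    intro k hmk hkn
    obtain ⟨h1, h2⟩ := ratio_le_of_recur hb hc.le hx hroot hrec hu hxu hmk hkn
    have h3 : 0 < u (k + 1) := (mul_pos hx h1).trans_le h2
    have h4 : y * u k ≤ 1 / q * u (k + 1) := by
      have h5 : y * (x * u k) ≤ y * u (k + 1) := by gcongr
      have h6 : y * q ≤ x := by
        have h7 : y * (b / c * x ^ 2) = x := by
          rw [hy]
          field_simp
        calc y * q ≤ y * (b / c * x ^ 2) := by gcongr
          _ = x := h7
      have h8 : q * (y * u k) ≤ u (k + 1) := by nlinarith
      rw [one_div, inv_mul_eq_div, le_div_iff₀ (by linarith)]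
      linarith
    exact ⟨by linarith, by linarith [mul_pos hy0 h1], h3⟩
  have hstep : ∀ k, m ≤ k → k < n →
      p (k + 1) * (u (k + 2) - y * u (k + 1)) ^ 2 ≤ b / c * x ^ 2 * (p k * (u (k + 1) - y * u k) ^ 2) := by
    intro k hmk hkn
    have h1 := hrec k hmk hkn
    have h2 : u (k + 2) - y * u (k + 1) = x * (u (k + 1) - y * u k) := by
      have h3 : b * x * y = c := by rw [hy]; field_simp
      refine mul_left_cancel₀ (mul_pos hb hx).ne' ?_
      linear_combination x * h1 - u (k + 1) * hroot + (x * u k - u (k + 1)) * h3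
    have h4 : p (k + 1) = p k * b / c := by
      have := hpk k hmk hkn
      field_simp
      linarith
    rw [h2, h4]
    apply le_of_eq
    ring
  have h := le_pow_sub_mul (f := fun k => p k * (u (k + 1) - y * u k) ^ 2) (by positivity) hmn hstep
  obtain ⟨h1, h2, h3⟩ := hdu m le_rfl hmn
  obtain ⟨h4, h5, h6⟩ := hdu n hmn le_rfl
  have hpm := hp m le_rfl hmn
  have hpn := hp n hmn le_rfl
  have h7 := mul_pos hq0 h3
  have h8 := mul_pos hq0 h6
  calc (1 - 1 / q) ^ 2 * (p n * u (n + 1) ^ 2) = p n * ((1 - 1 / q) * u (n + 1)) ^ 2 := by ring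
    _ ≤ p n * (u (n + 1) - y * u n) ^ 2 := by gcongr
    _ ≤ _ := h
    _ ≤ _ := by
      have : 0 ≤ u (m + 1) - y * u m := by linarith
      gcongr

/-! ### Solutions with constant coefficients and complex characteristic roots -/

/-- Each step multiplies the energy by c / b and the weight by b / c. -/
theorem weighted_energy_const (hb : 0 < b) (hc : 0 < c)
    (hpk : ∀ k, m ≤ k → k < n → p (k + 1) * c = p k * b)
    (hrec : ∀ k, m ≤ k → k < n → c * u k + e * u (k + 1) + b * u (k + 2) = 0)
    {k : ℕ} (hmk : m ≤ k) (hkn : k ≤ n) :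
    p k * energy b e c (u k) (u (k + 1)) = p m * energy b e c (u m) (u (m + 1)) := by
  induction k, hmk using Nat.le_induction with
  | base => rfl
  | succ k hmk ih =>
    rw [← ih (by omega)]
    have h1 := hpk k hmk (by omega)
    have h2 := energy_step (hrec k hmk (by omega))
    refine mul_left_cancel₀ (mul_pos hb hc).ne' ?_
    linear_combination (p (k + 1) * c) * h2 + c * energy b e c (u k) (u (k + 1)) * h1

end ConstantCoefficients

namespace GraphicalSeq

variable {κ lam : ℕ}

/-! ### Partial sums of the block lengths -/

/-- The number of indices `m ≥ 1` in the blocks before the `i`-th one. -/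
def offset (ℓ : ℕ → ℕ) (i : ℕ) : ℕ := ∑ j ∈ Ico 1 i, ℓ j

theorem s_eq (ℓ : ℕ → ℕ) (i : ℕ) : s ℓ i = offset ℓ i + 1 := by
  rw [s, offset, add_comm]

theorem offset_one (ℓ : ℕ → ℕ) : offset ℓ 1 = 0 := by
  simp [offset]

theorem offset_succ (ℓ : ℕ → ℕ) {i : ℕ} (hi : 1 ≤ i) : offset ℓ (i + 1) = offset ℓ i + ℓ i :=
  sum_Ico_succ_top hi _

theorem offset_mono (ℓ : ℕ → ℕ) : Monotone (offset ℓ) := fun _ _ hab =>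
  sum_le_sum_of_subset (Ico_subset_Ico_right hab)

theorem sum_Ico_add_offset (ℓ : ℕ → ℕ) {i j : ℕ} (hi : 1 ≤ i) (hij : i ≤ j) :
    ∑ k ∈ Ico i j, ℓ k + offset ℓ i = offset ℓ j := by
  rw [add_comm]
  exact sum_Ico_consecutive _ hi hij

theorem exists_offset_le (ℓ : ℕ → ℕ) {i j k : ℕ} (hij : i ≤ j) (h1 : offset ℓ i ≤ k)
    (h2 : k < offset ℓ j) : ∃ t, i ≤ t ∧ t < j ∧ offset ℓ t ≤ k ∧ k < offset ℓ (t + 1) := by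
  induction j, hij using Nat.le_induction with
  | base => omega
  | succ j hij ih =>
    by_cases hk : k < offset ℓ j
    · obtain ⟨t, ht⟩ := ih hk
      exact ⟨t, ht.1, by omega, ht.2.2⟩
    · exact ⟨j, hij, by omega, by omega, h2⟩

/-- Positivity of the block lengths, with the last one equal to `1`. -/
structure Lengths (G : GraphicalSeq κ lam) (ℓ : ℕ → ℕ) : Prop where
  pos : ∀ i, 1 ≤ i → i ≤ G.g + 1 → 1 ≤ ℓ i
  last : ℓ (G.g + 1) = 1

theorem IsQuadruple.lengths {G : GraphicalSeq κ lam} {Δ : Finset ℕ} {L ℓ : ℕ → ℕ}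
    (h : G.IsQuadruple Δ L ℓ) : G.Lengths ℓ := ⟨h.ℓ_pos, h.ℓ_last⟩

variable (G : GraphicalSeq κ lam) (ℓ : ℕ → ℕ)

theorem diam_eq : G.diam ℓ = offset ℓ (G.g + 1) + 1 := s_eq _ _

/-- As `offset` is s(i) - 1, the i-th block consists of the indices k + 1 with offset i ≤ k < offset
(i + 1). The later estimates are indexed by this k. -/
theorem block_succ {i k : ℕ} (hi : 1 ≤ i) (hig : i ≤ G.g + 1) (h1 : offset ℓ i ≤ k)
    (h2 : k < offset ℓ (i + 1)) : G.block ℓ (k + 1) = i := by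
  rw [offset_succ _ hi] at h2
  have := G.block_eq ℓ hi hig (show k - offset ℓ i < ℓ i by omega)
  rw [s_eq] at this
  rwa [show offset ℓ i + 1 + (k - offset ℓ i) = k + 1 by omega] at this

theorem c_succ {i k : ℕ} (hi : 1 ≤ i) (hig : i ≤ G.g + 1) (h1 : offset ℓ i ≤ k)
    (h2 : k < offset ℓ (i + 1)) : G.c ℓ (k + 1) = G.γ i := by
  simp [c, G.block_succ ℓ hi hig h1 h2]

theorem a_succ {i k : ℕ} (hi : 1 ≤ i) (hig : i ≤ G.g + 1) (h1 : offset ℓ i ≤ k)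
    (h2 : k < offset ℓ (i + 1)) : G.a ℓ (k + 1) = G.α i := by
  simp [a, G.block_succ ℓ hi hig h1 h2]

theorem b_succ {i k : ℕ} (hi : 1 ≤ i) (hig : i ≤ G.g + 1) (h1 : offset ℓ i ≤ k)
    (h2 : k < offset ℓ (i + 1)) : G.b ℓ (k + 1) = G.β i := by
  simp [b, G.block_succ ℓ hi hig h1 h2]

/-! ### Elementary properties of the triples -/

theorem one_le_β {i : ℕ} (h1 : 1 ≤ i) (h2 : i ≤ G.g) : (1 : ℝ) ≤ G.β i := by
  exact_mod_cast (G.G0 i h1 h2).1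

theorem γ_one : G.γ 1 = 1 := congrArg Prod.fst G.G1

theorem one_le_γ {i : ℕ} (h1 : 1 ≤ i) (h2 : i ≤ G.g + 1) : (1 : ℝ) ≤ G.γ i := by
  have h : 1 ≤ G.γ i := by
    induction i, h1 using Nat.le_induction with
    | base => exact G.γ_one.ge
    | succ i hi ih => exact (ih (by omega)).trans (G.G2_γ i hi (by omega))
  exact_mod_cast h

theorem triple_sum {i : ℕ} (h1 : 1 ≤ i) (h2 : i ≤ G.g + 1) : (G.γ i : ℝ) + G.α i + G.β i = κ := by
  rcases h2.lt_or_eq with h | rfl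
  · exact_mod_cast (G.G0 i h1 (by omega)).2.2.1
  · rw [G.G3.1]
    exact_mod_cast G.G3.2

theorem β_antitone {i j : ℕ} (hi : 1 ≤ i) (hij : i ≤ j) (hj : j ≤ G.g) : G.β j ≤ G.β i := by
  induction j, hij using Nat.le_induction with
  | base => exact le_rfl
  | succ j hij ih => exact (G.G2_β j (by omega) hj).trans (ih (by omega))

theorem γ_monotone {i j : ℕ} (hi : 1 ≤ i) (hij : i ≤ j) (hj : j ≤ G.g + 1) : G.γ i ≤ G.γ j := by
  induction j, hij using Nat.le_induction with
  | base => exact le_rfl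
  | succ j hij ih => exact (ih (by omega)).trans (G.G2_γ j (by omega) (by omega))

/-! ### The valencies and the standard sequence -/

/-- Every `k ≤ offset (g + 1)` lies in one of the blocks. -/
theorem Lengths.exists_block {G : GraphicalSeq κ lam} {ℓ : ℕ → ℕ} (hℓ : G.Lengths ℓ) {k : ℕ} (hk : k ≤ offset ℓ (G.g + 1)) :
    ∃ i, 1 ≤ i ∧ i ≤ G.g + 1 ∧ offset ℓ i ≤ k ∧ k < offset ℓ (i + 1) := by
  -- The bound g + 2 includes the last block, which has length 1.
  obtain ⟨t, h1, h2, h3, h4⟩ := exists_offset_le ℓ (i := 1) (j := G.g + 2) (by omega)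
    (k := k) (by simp [offset_one]) (by rw [offset_succ _ (by omega), hℓ.last]; omega)
  exact ⟨t, h1, by omega, h3, h4⟩

variable {G ℓ}

theorem Lengths.c_one (hℓ : G.Lengths ℓ) : G.c ℓ 1 = 1 := by
  rw [G.c_succ ℓ (i := 1) le_rfl (by omega) (offset_one ℓ).le
    (by rw [offset_succ _ le_rfl, offset_one]; have := hℓ.pos 1 le_rfl (by omega); omega)]
  exact_mod_cast G.γ_one

theorem Lengths.one_le_c (hℓ : G.Lengths ℓ) {k : ℕ} (hk : k ≤ offset ℓ (G.g + 1)) : 1 ≤ G.c ℓ (k + 1) := by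
  obtain ⟨i, h1, h2, h3, h4⟩ := hℓ.exists_block hk
  rw [G.c_succ ℓ h1 h2 h3 h4]
  exact G.one_le_γ h1 h2

theorem Lengths.c_le (hℓ : G.Lengths ℓ) {k : ℕ} (hk : k ≤ offset ℓ (G.g + 1)) : G.c ℓ (k + 1) ≤ κ := by
  obtain ⟨i, h1, h2, h3, h4⟩ := hℓ.exists_block hk
  rw [G.c_succ ℓ h1 h2 h3 h4, ← G.triple_sum h1 h2]
  have : (0 : ℝ) ≤ G.α i := by positivity
  have : (0 : ℝ) ≤ G.β i := by positivity
  linarith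

theorem Lengths.sum_eq (hℓ : G.Lengths ℓ) {k : ℕ} (hk : k ≤ offset ℓ (G.g + 1)) :
    G.c ℓ (k + 1) + G.a ℓ (k + 1) + G.b ℓ (k + 1) = κ := by
  obtain ⟨i, h1, h2, h3, h4⟩ := hℓ.exists_block hk
  rw [G.c_succ ℓ h1 h2 h3 h4, G.a_succ ℓ h1 h2 h3 h4, G.b_succ ℓ h1 h2 h3 h4, G.triple_sum h1 h2]

theorem b_pos (hκ : 0 < κ) {k : ℕ} (hk : k ≤ offset ℓ (G.g + 1)) : 0 < G.b ℓ k := by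
  rcases k with _ | k
  · simpa [b] using hκ
  obtain ⟨i, h1, h2, h3, h4⟩ := exists_offset_le ℓ (i := 1) (j := G.g + 1) (by omega)
    (k := k) (by simp [offset_one]) (by omega)
  rw [G.b_succ ℓ h1 (by omega) h3 h4]
  exact zero_lt_one.trans_le (G.one_le_β h1 (by omega))

theorem kap_zero : G.kap ℓ 0 = 1 := by
  simp [kap, v]

theorem c_mul_eval_v (hℓ : G.Lengths ℓ) {k : ℕ} (hk : k + 1 ≤ offset ℓ (G.g + 1)) (x : ℝ) :
    G.c ℓ (k + 2) * (G.v ℓ (k + 2)).eval x =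
      (x - G.a ℓ (k + 1)) * (G.v ℓ (k + 1)).eval x - G.b ℓ k * (G.v ℓ k).eval x := by
  have := hℓ.one_le_c hk
  rw [v]
  simp only [Polynomial.eval_mul, Polynomial.eval_C, Polynomial.eval_sub, Polynomial.eval_X]
  rw [mul_inv_cancel_left₀ (by linarith)]

/-- Detailed balance: since rows sum to κ, the three-term recurrence for v at κ collapses by
induction to a two-term one. -/
theorem kap_mul_c (hℓ : G.Lengths ℓ) {k : ℕ} (hk : k ≤ offset ℓ (G.g + 1)) :
    G.kap ℓ (k + 1) * G.c ℓ (k + 1) = G.kap ℓ k * G.b ℓ k := by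
  induction k with
  | zero => simp [kap, v, hℓ.c_one, b]
  | succ k ih =>
    have h := c_mul_eval_v hℓ hk (κ : ℝ)
    have h1 := ih (by omega)
    have h2 := hℓ.sum_eq (k := k) (by omega)
    unfold kap at h1 ⊢
    linear_combination h + h1 - (Polynomial.eval (κ : ℝ) (G.v ℓ (k + 1))) * h2

theorem kap_pos (hℓ : G.Lengths ℓ) (hκ : 0 < κ) {k : ℕ} (hk : k ≤ offset ℓ (G.g + 1) + 1) :
    0 < G.kap ℓ k := by
  induction k with
  | zero => simp [kap_zero]
  | succ k ih =>
    have h := kap_mul_c hℓ (k := k) (by omega)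
    have h1 := mul_pos (ih (by omega)) (b_pos (G := G) (ℓ := ℓ) hκ (k := k) (by omega))
    rw [← h] at h1
    exact pos_of_mul_pos_left h1 (zero_le_one.trans (hℓ.one_le_c (by omega)))

theorem u_zero (x : ℝ) : G.u ℓ 0 x = 1 := by
  simp [u, kap_zero, v]

theorem u_one (x : ℝ) : G.u ℓ 1 x = x / κ := by
  simp [u, kap, v]

theorem u_rec (hℓ : G.Lengths ℓ) (hκ : 0 < κ) {k : ℕ} (hk : k < offset ℓ (G.g + 1)) (x : ℝ) :
    G.c ℓ (k + 1) * G.u ℓ k x + (G.a ℓ (k + 1) - x) * G.u ℓ (k + 1) x +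
      G.b ℓ (k + 1) * G.u ℓ (k + 2) x = 0 := by
  have h := c_mul_eval_v hℓ (k := k) hk x
  have h0 := kap_pos hℓ hκ (k := k) (by omega)
  have h1 := kap_pos hℓ hκ (k := k + 1) (by omega)
  have h2 := kap_pos hℓ hκ (k := k + 2) (by omega)
  have e1 := kap_mul_c hℓ (k := k) (by omega)
  have e2 := kap_mul_c hℓ (k := k + 1) (by omega)
  have f : ∀ j, 0 < G.kap ℓ j → (G.v ℓ j).eval x = G.kap ℓ j * G.u ℓ j x := fun j hj => by
    rw [u]; field_simp
  rw [f _ h0, f _ h1, f _ h2] at h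
  refine (mul_eq_zero.1 ?_).resolve_left h1.ne'
  linear_combination h + G.u ℓ k x * e1 - G.u ℓ (k + 2) x * e2

/-! ### Solutions of the recurrence, block by block -/

/-- `u` satisfies the recurrence of the standard sequence at `θ` in the first `g` blocks, and `p` is
a sequence of positive weights with `p (k + 1) = (β_i / γ_i) p k` in the `i`-th block. -/
structure IsSolution (G : GraphicalSeq κ lam) (ℓ : ℕ → ℕ) (θ : ℝ) (p u : ℕ → ℝ) : Prop where
  pos : ∀ k, k ≤ offset ℓ (G.g + 1) → 0 < p k
  weight : ∀ i k, 1 ≤ i → i ≤ G.g → offset ℓ i ≤ k → k < offset ℓ (i + 1) →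
    p (k + 1) * G.γ i = p k * G.β i
  recur : ∀ i k, 1 ≤ i → i ≤ G.g → offset ℓ i ≤ k → k < offset ℓ (i + 1) →
    G.γ i * u k + (G.α i - θ) * u (k + 1) + G.β i * u (k + 2) = 0

/-- The weight κ_{k+1} c_{k+1} is preferred to κ_{k+1} because its ratio b_{k+1} / c_{k+1} involves
a single row, so nothing jumps at a block boundary. -/
theorem isSolution_u (hℓ : G.Lengths ℓ) (hκ : 0 < κ) (θ : ℝ) :
    G.IsSolution ℓ θ (fun k => G.kap ℓ (k + 1) * G.c ℓ (k + 1)) (fun k => G.u ℓ k θ) where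
  pos k hk := mul_pos (kap_pos hℓ hκ (by omega)) (zero_lt_one.trans_le (hℓ.one_le_c hk))
  weight i k h1 h2 h3 h4 := by
    have h5 := offset_mono ℓ (show i + 1 ≤ G.g + 1 by omega)
    have h := kap_mul_c hℓ (k := k + 1) (by omega)
    rw [h, ← G.c_succ ℓ h1 (by omega) h3 h4, ← G.b_succ ℓ h1 (by omega) h3 h4]
    ring
  recur i k h1 h2 h3 h4 := by
    have h5 := offset_mono ℓ (show i + 1 ≤ G.g + 1 by omega)
    have h := u_rec hℓ hκ (k := k) (by omega) θ
    rwa [G.c_succ ℓ h1 (by omega) h3 h4, G.b_succ ℓ h1 (by omega) h3 h4,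
      G.a_succ ℓ h1 (by omega) h3 h4] at h

/-! ### The condition at the last row for eigenvalues -/

/-- Extending the vector by zero beyond D lets the last row obey the same formula as the others. -/
theorem tridiagMatrix_mulVec (w : ℕ → ℝ) (hw : ∀ k, G.diam ℓ < k → w k = 0) (k : ℕ)
    (hk : k + 1 < G.diam ℓ + 1) :
    (G.tridiagMatrix ℓ).mulVec (fun j => w j) ⟨k + 1, hk⟩ =
      G.c ℓ (k + 1) * w k + G.a ℓ (k + 1) * w (k + 1) + G.b ℓ (k + 1) * w (k + 2) := by
  have h : ∀ j : ℕ, (if j + 1 = k + 1 then G.c ℓ (k + 1) else if j = k + 1 then G.a ℓ (k + 1)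
      else if j = k + 1 + 1 then G.b ℓ (k + 1) else 0) * w j =
      (if j = k then G.c ℓ (k + 1) * w k else 0) + (if j = k + 1 then G.a ℓ (k + 1) * w (k + 1) else 0) +
        (if j = k + 2 then G.b ℓ (k + 1) * w (k + 2) else 0) := fun j => by
    split_ifs <;> first | omega | (subst_vars; simp_all)
  simp only [Matrix.mulVec, dotProduct, tridiagMatrix, Matrix.of_apply]
  rw [← Finset.sum_range (fun j => (if j + 1 = k + 1 then G.c ℓ (k + 1) else if j = k + 1 then G.a ℓ (k + 1)
      else if j = k + 1 + 1 then G.b ℓ (k + 1) else 0) * w j)]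
  simp only [h, sum_add_distrib, Finset.sum_ite_eq', Finset.mem_range]
  rw [if_pos (show k < G.diam ℓ + 1 by omega), if_pos hk]
  split_ifs with h2
  · rfl
  · rw [hw (k + 2) (by omega), mul_zero]

theorem tridiagMatrix_mulVec_zero (w : ℕ → ℝ) (hd : 1 ≤ G.diam ℓ) :
    (G.tridiagMatrix ℓ).mulVec (fun j => w j) ⟨0, Nat.succ_pos _⟩ = κ * w 1 := by
  have h : ∀ j : ℕ, (if j + 1 = 0 then G.c ℓ 0 else if j = 0 then G.a ℓ 0
      else if j = 0 + 1 then G.b ℓ 0 else 0) * w j = (if j = 1 then κ * w 1 else 0) := fun j => by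
    split_ifs <;> first | omega | (subst_vars; simp_all [a, b])
  simp only [Matrix.mulVec, dotProduct, tridiagMatrix, Matrix.of_apply]
  rw [← Finset.sum_range (fun j => (if j + 1 = 0 then G.c ℓ 0 else if j = 0 then G.a ℓ 0
      else if j = 0 + 1 then G.b ℓ 0 else 0) * w j)]
  simp only [h, Finset.sum_ite_eq', Finset.mem_range]
  rw [if_pos (by omega)]

/-- Since b_k ≠ 0 for k < D, the rows before the last determine each entry from the previous ones.
An eigenvector is thus a nonzero multiple of the standard sequence, and the last row is the asserted
relation. -/
theorem last_row_of_mem_eigenvalues (hℓ : G.Lengths ℓ) (hκ : 0 < κ) {θ : ℝ}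
    (hθ : θ ∈ G.eigenvalues ℓ) :
    G.γ (G.g + 1) * G.u ℓ (offset ℓ (G.g + 1)) θ =
      (θ - G.α (G.g + 1)) * G.u ℓ (offset ℓ (G.g + 1) + 1) θ := by
  obtain ⟨w, hw⟩ := Module.End.HasEigenvalue.exists_hasEigenvector hθ
  have hmul : (G.tridiagMatrix ℓ).mulVec w = θ • w := by
    simpa using hw.apply_eq_smul
  have hd := G.diam_eq ℓ
  set W : ℕ → ℝ := fun k => if h : k < G.diam ℓ + 1 then w ⟨k, h⟩ else 0 with hW
  have hWw : (fun j : Fin (G.diam ℓ + 1) => W j) = w := by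
    ext j
    exact dif_pos j.2
  have hW0 : ∀ k, G.diam ℓ < k → W k = 0 := fun k hk =>
    dif_neg (by omega)
  have hrow : ∀ k, k + 1 < G.diam ℓ + 1 →
      G.c ℓ (k + 1) * W k + G.a ℓ (k + 1) * W (k + 1) + G.b ℓ (k + 1) * W (k + 2) = θ * W (k + 1) :=
    fun k hk => by
      rw [← tridiagMatrix_mulVec W hW0 k hk, hWw, hmul]
      simp [hW, show k < G.diam ℓ by omega]
  have hrow0 : κ * W 1 = θ * W 0 := by
    rw [← tridiagMatrix_mulVec_zero (G := G) (ℓ := ℓ) W (by omega), hWw, hmul]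
    simp [hW]
  have hκ' : (κ : ℝ) ≠ 0 := by positivity
  have key : ∀ k, k ≤ offset ℓ (G.g + 1) →
      W k = W 0 * G.u ℓ k θ ∧ W (k + 1) = W 0 * G.u ℓ (k + 1) θ := by
    intro k
    induction k with
    | zero =>
      intro _
      refine ⟨by rw [u_zero, mul_one], ?_⟩
      rw [u_one]
      field_simp
      linarith
    | succ k ih =>
      intro hk
      obtain ⟨h1, h2⟩ := ih (by omega)
      refine ⟨h2, ?_⟩
      have h3 := hrow k (by omega)
      have h4 := u_rec hℓ hκ (k := k) (by omega) θ
      have h5 := b_pos hκ (k := k + 1) (by omega)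
      rw [h1, h2] at h3
      refine mul_left_cancel₀ h5.ne' ?_
      linear_combination h3 - W 0 * h4
  have hne : W 0 ≠ 0 := by
    intro h0
    apply hw.2
    rw [← hWw]
    ext j
    have hj := j.2
    rcases Nat.eq_zero_or_pos (j : ℕ) with hj0 | hj0
    · simp only [hj0, h0, Pi.zero_apply]
    · have := (key ((j : ℕ) - 1) (by omega)).2
      rw [show (j : ℕ) - 1 + 1 = j by omega, h0, zero_mul] at this
      exact this
  have h6 := hrow (offset ℓ (G.g + 1)) (by omega)
  obtain ⟨h7, h8⟩ := key _ le_rfl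
  rw [h7, h8, hW0 (offset ℓ (G.g + 1) + 2) (by omega)] at h6
  have h9 : offset ℓ (G.g + 1) < offset ℓ (G.g + 1 + 1) := by
    rw [offset_succ _ (show 1 ≤ G.g + 1 by omega), hℓ.last]
    omega
  rw [G.c_succ ℓ (by omega) le_rfl le_rfl h9, G.a_succ ℓ (by omega) le_rfl le_rfl h9] at h6
  refine mul_left_cancel₀ hne ?_
  linear_combination h6

end GraphicalSeq

namespace GraphicalSeq

variable {κ lam : ℕ} {G : GraphicalSeq κ lam} {lo hi : ℝ}

/-! ### Position of the guide points -/

/-- In this form R_i depends on √β_i - √γ_i alone, a quantity decreasing in i; R_i is larger the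
closer it is to 0. -/
theorem R_eq (G : GraphicalSeq κ lam) {i : ℕ} (h1 : 1 ≤ i) (h2 : i ≤ G.g) :
    G.R i = κ - (√(G.β i : ℝ) - √(G.γ i : ℝ)) ^ 2 := by
  have hb : (0 : ℝ) ≤ G.β i := Nat.cast_nonneg _
  have hc : (0 : ℝ) ≤ G.γ i := Nat.cast_nonneg _
  rw [R, Real.sqrt_mul hb, ← G.triple_sum h1 (by omega)]
  linear_combination Real.sq_sqrt hb + Real.sq_sqrt hc

theorem R_le (G : GraphicalSeq κ lam) {i : ℕ} (h1 : 1 ≤ i) (h2 : i ≤ G.g) : G.R i ≤ κ := by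
  rw [G.R_eq h1 h2]
  linarith [sq_nonneg (√(G.β i : ℝ) - √(G.γ i : ℝ))]

theorem α_le_R (G : GraphicalSeq κ lam) (i : ℕ) : (G.α i : ℝ) ≤ G.R i := by
  rw [R]
  linarith [Real.sqrt_nonneg ((G.β i : ℝ) * G.γ i)]

theorem Lft_le_R (G : GraphicalSeq κ lam) (i : ℕ) : G.Lft i ≤ G.R i := by
  rw [R, Lft]
  linarith [Real.sqrt_nonneg ((G.β i : ℝ) * G.γ i)]

theorem sqrt_sub_sqrt_antitone (G : GraphicalSeq κ lam) {i j : ℕ} (hi : 1 ≤ i) (hij : i ≤ j) (hj : j ≤ G.g) :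
    √(G.β j : ℝ) - √(G.γ j : ℝ) ≤ √(G.β i : ℝ) - √(G.γ i : ℝ) := by
  have h1 := Real.sqrt_le_sqrt (Nat.cast_le (α := ℝ).2 (G.β_antitone hi hij hj))
  have h2 := Real.sqrt_le_sqrt (Nat.cast_le (α := ℝ).2 (G.γ_monotone hi hij (by omega)))
  linarith

/-- The sequence of right guide points is unimodal. -/
theorem min_R_le (G : GraphicalSeq κ lam) {i j k : ℕ} (hi : 1 ≤ i) (hij : i ≤ j) (hjk : j ≤ k) (hk : k ≤ G.g) :
    min (G.R i) (G.R k) ≤ G.R j := by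
  have h1 := G.sqrt_sub_sqrt_antitone hi hij (by omega)
  have h2 := G.sqrt_sub_sqrt_antitone (by omega) hjk hk
  rw [G.R_eq hi (by omega), G.R_eq (by omega) hk, G.R_eq (by omega) (by omega)]
  rcases le_total 0 (√(G.β j : ℝ) - √(G.γ j : ℝ)) with h | h
  · exact min_le_of_left_le (by nlinarith)
  · exact min_le_of_right_le (by nlinarith)

/-- If γ_i ≥ β_i, then √β - √γ is nonpositive at i and only moves away from 0 afterwards, so R
cannot increase. -/
theorem γ_lt_β_of_R_lt (G : GraphicalSeq κ lam) {i j : ℕ} (hi : 1 ≤ i) (hij : i ≤ j) (hj : j ≤ G.g)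
    (h : G.R i < G.R j) : (G.γ i : ℝ) < G.β i := by
  have h1 := G.sqrt_sub_sqrt_antitone hi hij hj
  rw [G.R_eq hi (by omega), G.R_eq (by omega) hj] at h
  by_contra! hc
  have := Real.sqrt_le_sqrt hc
  nlinarith

theorem β_lt_γ_of_R_lt (G : GraphicalSeq κ lam) {i j : ℕ} (hi : 1 ≤ i) (hij : i ≤ j) (hj : j ≤ G.g)
    (h : G.R j < G.R i) : (G.β j : ℝ) < G.γ j := by
  have h1 := G.sqrt_sub_sqrt_antitone hi hij hj
  rw [G.R_eq hi (by omega), G.R_eq (by omega) hj] at h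
  by_contra! hc
  have := Real.sqrt_le_sqrt hc
  nlinarith

/-! ### The indices attached to a well-placed interval -/

theorem WellPlaced.R_one_lt (hI : G.WellPlaced lo hi) : G.R 1 < lo :=
  (hI.W1 ⟨le_rfl, hI.pos_length.le⟩).1

theorem WellPlaced.lo_pos (hI : G.WellPlaced lo hi) : 0 < lo :=
  ((Nat.cast_nonneg (G.α 1)).trans (G.α_le_R 1)).trans_lt hI.R_one_lt

theorem WellPlaced.nonempty (hI : G.WellPlaced lo hi) :
    {i | 2 ≤ i ∧ i ≤ G.g ∧ hi < G.R i}.Nonempty := by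
  have h : hi < G.Rmax := (hI.W1 ⟨hI.pos_length.le, le_rfl⟩).2
  have hne : (G.R '' Set.Icc 1 G.g).Nonempty := by
    by_contra hc
    rw [Set.not_nonempty_iff_eq_empty] at hc
    rw [Rmax, hc, Real.sSup_empty] at h
    linarith [hI.lo_pos, hI.pos_length]
  obtain ⟨_, ⟨i, ⟨h1, h2⟩, rfl⟩, h3⟩ := exists_lt_of_lt_csSup hne h
  refine ⟨i, ?_, h2, h3⟩
  by_contra hc
  obtain rfl : i = 1 := by omega
  linarith [hI.R_one_lt, hI.pos_length]

theorem WellPlaced.fa_mem (hI : G.WellPlaced lo hi) : 2 ≤ G.fa hi ∧ G.fa hi ≤ G.g ∧ hi < G.R (G.fa hi) :=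
  Nat.sInf_mem hI.nonempty

theorem bddAbove_right (G : GraphicalSeq κ lam) (hi : ℝ) : BddAbove {i | 2 ≤ i ∧ i ≤ G.g ∧ hi < G.R i} :=
  ⟨G.g, fun _ h => h.2.1⟩

theorem WellPlaced.fb_mem (hI : G.WellPlaced lo hi) : 2 ≤ G.fb hi ∧ G.fb hi ≤ G.g ∧ hi < G.R (G.fb hi) :=
  Nat.sSup_mem hI.nonempty (G.bddAbove_right hi)

theorem le_fb {i : ℕ} (h1 : 2 ≤ i) (h2 : i ≤ G.g) (h : hi < G.R i) : i ≤ G.fb hi :=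
  le_csSup (G.bddAbove_right hi) ⟨h1, h2, h⟩

theorem fa_le {i : ℕ} (h1 : 2 ≤ i) (h2 : i ≤ G.g) (h : hi < G.R i) : G.fa hi ≤ i :=
  Nat.sInf_le ⟨h1, h2, h⟩

theorem WellPlaced.fa_le_fb (hI : G.WellPlaced lo hi) : G.fa hi ≤ G.fb hi :=
  le_fb hI.fa_mem.1 hI.fa_mem.2.1 hI.fa_mem.2.2

theorem WellPlaced.lt_R (hI : G.WellPlaced lo hi) {i : ℕ} (h1 : G.fa hi ≤ i) (h2 : i ≤ G.fb hi) :
    hi < G.R i :=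
  (lt_min hI.fa_mem.2.2 hI.fb_mem.2.2).trans_le
    (G.min_R_le (by linarith [hI.fa_mem.1]) h1 h2 hI.fb_mem.2.1)

theorem R_lt_of_not_lt (hguide : ∀ i, 1 ≤ i → i ≤ G.g → G.R i ∉ Set.Icc lo hi ∧ G.Lft i ∉ Set.Icc lo hi)
    {i : ℕ} (h1 : 1 ≤ i) (h2 : i ≤ G.g) (h : ¬ hi < G.R i) : G.R i < lo := by
  by_contra! hc
  exact (hguide i h1 h2).1 ⟨hc, not_lt.1 h⟩

theorem WellPlaced.head (hI : G.WellPlaced lo hi)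
    (hguide : ∀ i, 1 ≤ i → i ≤ G.g → G.R i ∉ Set.Icc lo hi ∧ G.Lft i ∉ Set.Icc lo hi)
    {i : ℕ} (h1 : 1 ≤ i) (h2 : i < G.fa hi) : G.R i < lo ∧ (G.γ i : ℝ) < G.β i := by
  obtain ⟨h3, h4, h5⟩ := hI.fa_mem
  have h : G.R i < lo := by
    rcases h1.eq_or_lt with rfl | h6
    · exact hI.R_one_lt
    · exact R_lt_of_not_lt hguide h1 (by omega) fun hc => by
        have := fa_le h6 (by omega) hc
        omega
  exact ⟨h, G.γ_lt_β_of_R_lt h1 h2.le h4 (by linarith [hI.pos_length])⟩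

theorem WellPlaced.tail (hI : G.WellPlaced lo hi)
    (hguide : ∀ i, 1 ≤ i → i ≤ G.g → G.R i ∉ Set.Icc lo hi ∧ G.Lft i ∉ Set.Icc lo hi)
    {i : ℕ} (h1 : G.fb hi < i) (h2 : i ≤ G.g) : G.R i < lo ∧ (G.β i : ℝ) < G.γ i := by
  obtain ⟨h3, h4, h5⟩ := hI.fb_mem
  have h : G.R i < lo := R_lt_of_not_lt hguide (by omega) h2 fun hc => by
    have := le_fb (by omega) h2 hc
    omega
  exact ⟨h, G.β_lt_γ_of_R_lt (by omega) h1.le h2 (by linarith [hI.pos_length])⟩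

theorem fc_mem (G : GraphicalSeq κ lam) (hi : ℝ) :
    (2 ≤ G.fc hi ∧ G.fc hi ≤ G.g ∧ hi < G.Lft (G.fc hi)) ∨ G.fc hi = G.g + 1 := by
  have h : G.fc hi ∈ ({i | 2 ≤ i ∧ i ≤ G.g ∧ hi < G.Lft i} ∪ {G.g + 1} : Set ℕ) :=
    Nat.sInf_mem ⟨G.g + 1, Or.inr rfl⟩
  exact h

theorem fc_le {i : ℕ} (h1 : 2 ≤ i) (h2 : i ≤ G.g) (h : hi < G.Lft i) : G.fc hi ≤ i :=
  Nat.sInf_le (Or.inl ⟨h1, h2, h⟩)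

theorem bddAbove_left (G : GraphicalSeq κ lam) (hi : ℝ) :
    BddAbove ({i | 2 ≤ i ∧ i ≤ G.g ∧ hi < G.Lft i} ∪ {G.fc hi} : Set ℕ) := by
  refine ⟨max G.g (G.fc hi), ?_⟩
  rintro i (h | h)
  · exact le_max_of_le_left h.2.1
  · exact le_max_of_le_right (le_of_eq h)

theorem le_fd {i : ℕ} (h1 : 2 ≤ i) (h2 : i ≤ G.g) (h : hi < G.Lft i) : i ≤ G.fd hi :=
  le_csSup (G.bddAbove_left hi) (Or.inl ⟨h1, h2, h⟩)

theorem fc_le_fd (G : GraphicalSeq κ lam) (hi : ℝ) : G.fc hi ≤ G.fd hi :=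
  le_csSup (G.bddAbove_left hi) (Or.inr rfl)

theorem fd_le_fb (h : G.fc hi ≤ G.g) : G.fd hi ≤ G.fb hi := by
  have h1 : G.fd hi ∈ ({i | 2 ≤ i ∧ i ≤ G.g ∧ hi < G.Lft i} ∪ {G.fc hi} : Set ℕ) :=
    Nat.sSup_mem ⟨G.fc hi, Or.inr rfl⟩ (G.bddAbove_left hi)
  have h2 : 2 ≤ G.fc hi ∧ G.fc hi ≤ G.g ∧ hi < G.Lft (G.fc hi) :=
    (G.fc_mem hi).resolve_right (by omega)
  have h3 : 2 ≤ G.fd hi ∧ G.fd hi ≤ G.g ∧ hi < G.Lft (G.fd hi) := by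
    rcases h1 with h1 | h1
    · exact h1
    · rw [Set.mem_singleton_iff.1 h1]
      exact h2
  exact le_fb h3.1 h3.2.1 (h3.2.2.trans_le (G.Lft_le_R _))

/-- W3 places `hi` to the right of the left guide point of block `fa`, so the middle range does not
start with a gap. This is what makes `Len` positive. -/
theorem WellPlaced.fa_lt_fc (hI : G.WellPlaced lo hi) : G.fa hi < G.fc hi := by
  rcases G.fc_mem hi with h | h
  · refine lt_of_le_of_ne (fa_le h.1 h.2.1 (h.2.2.trans_le (G.Lft_le_R _))) fun he => ?_
    have h1 := (hI.W3 ⟨hI.pos_length.le, le_rfl⟩).1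
    rw [he] at h1
    linarith [h.2.2]
  · linarith [hI.fa_mem.2.1]

theorem Lft_lt_of_lt_fc_or_fd_lt
    (hguide : ∀ i, 1 ≤ i → i ≤ G.g → G.R i ∉ Set.Icc lo hi ∧ G.Lft i ∉ Set.Icc lo hi)
    {i : ℕ} (h1 : 2 ≤ i) (h2 : i ≤ G.g) (h : i < G.fc hi ∨ G.fd hi < i) : G.Lft i < lo := by
  have h3 : ¬ hi < G.Lft i := fun hc => by
    have h4 := fc_le h1 h2 hc
    have h5 := le_fd h1 h2 hc
    omega
  by_contra! hc
  exact (hguide i (by omega) h2).2 ⟨hc, not_lt.1 h3⟩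

/-! ### A uniform distance to the guide points -/

/-- The discriminant is (θ - R_i)(θ - L_i). For each i every small η > 0 works, hence one η serves
the finitely many blocks. -/
theorem exists_discr_bound (G : GraphicalSeq κ lam) (lo hi : ℝ) :
    ∃ η > 0, ∀ i, 1 ≤ i → i ≤ G.g → ∀ θ ∈ Set.Icc lo hi,
      (G.R i < lo → 4 * (G.β i : ℝ) * G.γ i + η ≤ (G.α i - θ) ^ 2) ∧
      (G.Lft i < lo → hi < G.R i → (G.α i - θ) ^ 2 + η ≤ 4 * (G.β i : ℝ) * G.γ i) := by
  have key : ∀ i ∈ Finset.Icc 1 G.g, ∀ᶠ η in nhdsWithin (0 : ℝ) (Set.Ioi 0), ∀ θ ∈ Set.Icc lo hi,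
      (G.R i < lo → 4 * (G.β i : ℝ) * G.γ i + η ≤ (G.α i - θ) ^ 2) ∧
      (G.Lft i < lo → hi < G.R i → (G.α i - θ) ^ 2 + η ≤ 4 * (G.β i : ℝ) * G.γ i) := by
    intro i _
    have hbc : (0 : ℝ) ≤ (G.β i : ℝ) * G.γ i := by positivity
    have hs := Real.sq_sqrt hbc
    have hs0 := Real.sqrt_nonneg ((G.β i : ℝ) * G.γ i)
    unfold R Lft
    set r := √((G.β i : ℝ) * G.γ i)
    simp only [forall_and]
    by_cases hR : (G.α i : ℝ) + 2 * r < lo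
    · have hpos : 0 < (lo - G.α i) ^ 2 - 4 * (G.β i : ℝ) * G.γ i := by nlinarith
      filter_upwards [Ioc_mem_nhdsGT hpos] with η hη
      refine ⟨fun θ hθ _ => ?_, fun θ hθ _ h => ?_⟩
      · have := hη.2
        nlinarith [hθ.1]
      · linarith [hθ.1, hθ.2]
    · by_cases hL : (G.α i : ℝ) - 2 * r < lo ∧ hi < G.α i + 2 * r
      · have hpos : 0 < min (lo - (G.α i - 2 * r)) (G.α i + 2 * r - hi) :=
          lt_min (by linarith [hL.1]) (by linarith [hL.2])
        set e := min (lo - (G.α i - 2 * r)) (G.α i + 2 * r - hi)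
        -- Here (θ - L_i)(R_i - θ) is at least e², with e the smaller distance to the guide points.
        filter_upwards [Ioc_mem_nhdsGT (mul_pos hpos hpos)] with η hη
        refine ⟨fun θ hθ h => absurd h hR, fun θ hθ _ _ => ?_⟩
        have h1 : e ≤ θ - (G.α i - 2 * r) := (min_le_left _ _).trans (by linarith [hθ.1])
        have h2 : e ≤ G.α i + 2 * r - θ := (min_le_right _ _).trans (by linarith [hθ.2])
        have h3 := mul_le_mul h1 h2 hpos.le (hpos.le.trans h1)
        linarith [hη.2]
      · filter_upwards with η
        exact ⟨fun θ hθ h => absurd h hR, fun θ hθ h1 h2 => absurd ⟨h1, h2⟩ hL⟩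
  obtain ⟨η, hη, hpos⟩ := (((Finset.eventually_all _).2 key).and self_mem_nhdsWithin).exists
  exact ⟨η, hpos, fun i h1 h2 => hη i (Finset.mem_Icc.2 ⟨h1, h2⟩)⟩

end GraphicalSeq

namespace GraphicalSeq

variable {κ lam : ℕ} {G : GraphicalSeq κ lam} {ℓ : ℕ → ℕ} {θ η : ℝ} {p u : ℕ → ℝ}

/-! ### Characteristic roots of a block and their monotonicity -/

theorem γ_le (G : GraphicalSeq κ lam) {i : ℕ} (h1 : 1 ≤ i) (h2 : i ≤ G.g + 1) : (G.γ i : ℝ) ≤ κ := by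
  rw [← G.triple_sum h1 h2, add_assoc]
  exact le_add_of_nonneg_right (by positivity)

theorem β_le (G : GraphicalSeq κ lam) {i : ℕ} (h1 : 1 ≤ i) (h2 : i ≤ G.g + 1) : (G.β i : ℝ) ≤ κ := by
  rw [← G.triple_sum h1 h2]
  exact le_add_of_nonneg_left (by positivity)

theorem abs_α_sub_le (G : GraphicalSeq κ lam) (h0 : 0 ≤ θ) (hθ : θ ≤ κ) {i : ℕ} (h1 : 1 ≤ i) (h2 : i ≤ G.g + 1) :
    |(G.α i : ℝ) - θ| ≤ κ := by
  have h3 := G.triple_sum h1 h2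
  have h4 : (0 : ℝ) ≤ G.γ i := by positivity
  have h5 : (0 : ℝ) ≤ G.β i := by positivity
  have h6 : (0 : ℝ) ≤ G.α i := by positivity
  rw [abs_le]
  constructor <;> linarith

/-- The ratio of the growth of `p k * u (k + 1) ^ 2` where the characteristic roots are real. -/
noncomputable def growth (κ : ℕ) (η : ℝ) : ℝ := 1 + η / (4 * (κ : ℝ) ^ 2)

theorem one_lt_growth (hκ : 0 < κ) (hη : 0 < η) : 1 < growth κ η := by
  unfold growth
  have : 0 < η / (4 * (κ : ℝ) ^ 2) := by positivity
  linarith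

/-- The characteristic roots of the `i`-th block at `θ` are real and positive, with a
discriminant bounded below by `η`. -/
def RealBlock (G : GraphicalSeq κ lam) (η θ : ℝ) (i : ℕ) : Prop :=
  (G.α i : ℝ) - θ < 0 ∧ 4 * (G.β i : ℝ) * G.γ i + η ≤ (G.α i - θ) ^ 2

/-- The characteristic roots of the `i`-th block at `θ` are not real, with minus the
discriminant bounded below by `η`. -/
def ComplexBlock (G : GraphicalSeq κ lam) (η θ : ℝ) (i : ℕ) : Prop :=
  (G.α i - θ) ^ 2 + η ≤ 4 * (G.β i : ℝ) * G.γ i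

/-- The larger root of `γ_i z² + (α_i - x) z + β_i`. -/
noncomputable def tau (G : GraphicalSeq κ lam) (i : ℕ) (x : ℝ) : ℝ :=
  bigRoot (G.γ i) (G.α i - x) (G.β i)

section Roots

variable {i : ℕ} (h1 : 1 ≤ i) (h2 : i ≤ G.g) (hη : 0 < η) (h : G.RealBlock η θ i)
include h1 h2

theorem β_pos' : (0 : ℝ) < G.β i := zero_lt_one.trans_le (G.one_le_β h1 h2)

theorem γ_pos' : (0 : ℝ) < G.γ i := zero_lt_one.trans_le (G.one_le_γ h1 (by omega))

include h

theorem rho_pos : 0 < G.rho i θ := bigRoot_pos (β_pos' h1 h2) h.1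

theorem tau_pos : 0 < G.tau i θ := bigRoot_pos (γ_pos' h1 h2) h.1

include hη

theorem rho_root : G.β i * G.rho i θ ^ 2 + (G.α i - θ) * G.rho i θ + G.γ i = 0 :=
  quadratic_bigRoot (β_pos' h1 h2) (by linarith [h.2])

theorem tau_root : G.γ i * G.tau i θ ^ 2 + (G.α i - θ) * G.tau i θ + G.β i = 0 :=
  quadratic_bigRoot (γ_pos' h1 h2) (by linarith [h.2])

theorem rho_lt_one (hθ : θ < κ) (hβγ : (G.γ i : ℝ) < G.β i) : G.rho i θ < 1 :=
  bigRoot_lt_one (β_pos' h1 h2) (by linarith [h.2]) hβγ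
    (by linarith [G.triple_sum h1 (show i ≤ G.g + 1 by omega)])

theorem tau_lt_one (hθ : θ < κ) (hβγ : (G.β i : ℝ) < G.γ i) : G.tau i θ < 1 :=
  bigRoot_lt_one (γ_pos' h1 h2) (by linarith [h.2]) hβγ
    (by linarith [G.triple_sum h1 (show i ≤ G.g + 1 by omega)])

theorem growth_le_rho : growth κ η ≤ (G.β i : ℝ) / G.γ i * G.rho i θ ^ 2 :=
  le_div_mul_bigRoot_sq (β_pos' h1 h2) (G.β_le h1 (by omega)) (γ_pos' h1 h2) (G.γ_le h1 (by omega))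
    h.1.le hη.le h.2

theorem growth_le_tau : growth κ η ≤ (G.γ i : ℝ) / G.β i * G.tau i θ ^ 2 :=
  le_div_mul_bigRoot_sq (γ_pos' h1 h2) (G.γ_le h1 (by omega)) (β_pos' h1 h2) (G.β_le h1 (by omega))
    h.1.le hη.le (by linarith [h.2])

end Roots

/-- The linear coefficient is (κ - θ) - β - γ. As β falls and γ rises with i, the i-th quadratic is
nonpositive at ρ_{i+1} ∈ (0, 1), by `quadratic_nonpos_of_root`. -/
theorem rho_succ_le {i : ℕ} (h1 : 1 ≤ i) (h2 : i + 1 ≤ G.g) (hη : 0 < η) (h : G.RealBlock η θ i)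
    (h' : G.RealBlock η θ (i + 1)) (hθ : θ < κ) (hβγ : (G.γ (i + 1) : ℝ) < G.β (i + 1)) :
    G.rho (i + 1) θ ≤ G.rho i θ := by
  have hr := rho_root (by omega) h2 hη h'
  refine le_bigRoot_of_quadratic_nonpos (β_pos' h1 (by omega)) h.1.le ?_
  rw [show (G.α (i + 1) : ℝ) - θ = (κ - θ) - G.β (i + 1) - G.γ (i + 1) by
    linarith [G.triple_sum (show 1 ≤ i + 1 by omega) (by omega)]] at hr
  rw [show (G.α i : ℝ) - θ = (κ - θ) - G.β i - G.γ i by linarith [G.triple_sum h1 (by omega)]]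
  exact quadratic_nonpos_of_root (by exact_mod_cast G.G2_β i h1 h2)
    (by exact_mod_cast G.G2_γ i h1 (by omega)) (rho_pos (by omega) h2 h').le
    (rho_lt_one (by omega) h2 hη h' hθ hβγ).le hr

theorem tau_le_succ {i : ℕ} (h1 : 1 ≤ i) (h2 : i + 1 ≤ G.g) (hη : 0 < η) (h : G.RealBlock η θ i)
    (h' : G.RealBlock η θ (i + 1)) (hθ : θ < κ) (hβγ : (G.β i : ℝ) < G.γ i) :
    G.tau i θ ≤ G.tau (i + 1) θ := by
  have hr := tau_root h1 (by omega) hη h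
  refine le_bigRoot_of_quadratic_nonpos (γ_pos' (by omega) h2) h'.1.le ?_
  rw [show (G.α (i + 1) : ℝ) - θ = (κ - θ) - G.γ (i + 1) - G.β (i + 1) by
    linarith [G.triple_sum (show 1 ≤ i + 1 by omega) (by omega)]]
  rw [show (G.α i : ℝ) - θ = (κ - θ) - G.γ i - G.β i by linarith [G.triple_sum h1 (by omega)]] at hr
  exact quadratic_nonpos_of_root (by exact_mod_cast G.G2_γ i h1 (by omega))
    (by exact_mod_cast G.G2_β i h1 h2) (tau_pos h1 (by omega) h).le
    (tau_lt_one h1 (by omega) hη h hθ hβγ).le hr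

/-- The ratio `θ / κ` at the start of the standard sequence is not smaller than `ρ_1`. -/
theorem rho_one_le (hg : 1 ≤ G.g) (hη : 0 < η) (h : G.RealBlock η θ 1) (hκ : 0 < κ) (hθ : θ < κ)
    (hβγ : (G.γ 1 : ℝ) < G.β 1) : G.rho 1 θ ≤ θ / κ := by
  have hr := rho_root le_rfl hg hη h
  have hx := rho_pos le_rfl hg h
  rw [show (G.α 1 : ℝ) - θ = (κ - θ) - G.β 1 - G.γ 1 by linarith [G.triple_sum le_rfl (show 1 ≤ G.g + 1 by omega)]] at hr
  -- The triple (0, 0, κ) of index 0 acts as one more block: its quadratic z (κ z - θ) has the root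
  -- θ / κ.
  have h3 := quadratic_nonpos_of_root (p := κ) (r := 0) (G.β_le le_rfl (by omega)) (by positivity)
    hx.le (rho_lt_one le_rfl hg hη h hθ hβγ).le hr
  rw [le_div_iff₀ (by positivity)]
  nlinarith

/-- The ratio in the boundary condition at the end of the sequence is not smaller than the
larger root in the last block. -/
theorem γ_mul_tau_le (hg : 1 ≤ G.g) (hη : 0 < η) (h : G.RealBlock η θ G.g) (hθ : θ < κ)
    (hβγ : (G.β G.g : ℝ) < G.γ G.g) : G.γ (G.g + 1) * G.tau G.g θ ≤ θ - G.α (G.g + 1) := by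
  have hr := tau_root hg le_rfl hη h
  have hx := tau_pos hg le_rfl h
  rw [show (G.α G.g : ℝ) - θ = (κ - θ) - G.γ G.g - G.β G.g by linarith [G.triple_sum hg (show G.g ≤ G.g + 1 by omega)]] at hr
  -- As β_{g+1} = 0, the last triple has the quadratic z (γ_{g+1} z - (θ - α_{g+1})).
  have h3 := quadratic_nonpos_of_root (p := G.γ (G.g + 1)) (r := 0)
    (by exact_mod_cast G.G2_γ G.g hg le_rfl) (by positivity)
    hx.le (tau_lt_one hg le_rfl hη h hθ hβγ).le hr
  have h4 := G.triple_sum (show 1 ≤ G.g + 1 by omega) le_rfl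
  rw [G.G3.1, Nat.cast_zero, add_zero] at h4
  nlinarith

/-! ### Blocks with real characteristic roots at the beginning -/

section Head

variable {A : ℕ} (hη : 0 < η) (hκ : 0 < κ) (hθ : θ < κ) (hA : A ≤ G.g)
  (hreal : ∀ i, 1 ≤ i → i < A → G.RealBlock η θ i ∧ (G.γ i : ℝ) < G.β i)
  (hs : G.IsSolution ℓ θ p u) (hu0 : 0 < u 0) (hu1 : θ / κ * u 0 ≤ u 1)
include hη hκ hθ hA hreal hs hu0 hu1

/-- The ratio bound passes into the next block because ρ_{i+1} ≤ ρ_i, and it holds at the start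
because ρ_1 ≤ θ / κ. -/
theorem head_start {i : ℕ} (h1 : 1 ≤ i) (h2 : i < A) :
    0 < u (offset ℓ i) ∧ G.rho i θ * u (offset ℓ i) ≤ u (offset ℓ i + 1) := by
  induction i, h1 using Nat.le_induction with
  | base =>
    rw [offset_one]
    refine ⟨hu0, le_trans ?_ hu1⟩
    obtain ⟨h3, h4⟩ := hreal 1 le_rfl h2
    have := rho_one_le (by omega) hη h3 hκ hθ h4
    gcongr
  | succ i h1 ih =>
    obtain ⟨h3, h4⟩ := ih (by omega)
    obtain ⟨h5, h6⟩ := hreal i h1 (by omega)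
    obtain ⟨h7, h8⟩ := hreal (i + 1) (by omega) h2
    obtain ⟨h9, h10⟩ := ratio_le_of_recur (β_pos' h1 (by omega)) (γ_pos' h1 (by omega)).le
      (rho_pos h1 (by omega) h5) (rho_root h1 (by omega) hη h5)
      (fun k hk hk' => hs.recur i k h1 (by omega) hk hk') h3 h4
      (offset_mono ℓ (Nat.le_succ i)) le_rfl
    refine ⟨h9, le_trans ?_ h10⟩
    have := rho_succ_le h1 (by omega) hη h5 h7 hθ h8
    gcongr

theorem head_ratio {i k : ℕ} (h1 : 1 ≤ i) (h2 : i < A) (h3 : offset ℓ i ≤ k)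
    (h4 : k ≤ offset ℓ (i + 1)) : 0 < u k ∧ G.rho i θ * u k ≤ u (k + 1) := by
  obtain ⟨h5, h6⟩ := head_start hη hκ hθ hA hreal hs hu0 hu1 h1 h2
  exact ratio_le_of_recur (β_pos' h1 (by omega)) (γ_pos' h1 (by omega)).le
    (rho_pos h1 (by omega) (hreal i h1 h2).1) (rho_root h1 (by omega) hη (hreal i h1 h2).1)
    (fun k hk hk' => hs.recur i k h1 (by omega) hk hk') h5 h6 h3 h4

theorem head_growth_block {i k : ℕ} (h1 : 1 ≤ i) (h2 : i < A) (h3 : offset ℓ i ≤ k)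
    (h4 : k < offset ℓ (i + 1)) :
    (G.β i : ℝ) / G.γ i * G.rho i θ ^ 2 * (p k * u (k + 1) ^ 2) ≤ p (k + 1) * u (k + 2) ^ 2 := by
  obtain ⟨h5, h6⟩ := head_ratio hη hκ hθ hA hreal hs hu0 hu1 h1 h2 (show offset ℓ i ≤ k + 1 by omega) h4
  have h7 := offset_mono ℓ (show i + 1 ≤ G.g + 1 by omega)
  exact weighted_growth_step (β_pos' h1 (by omega)) (γ_pos' h1 (by omega))
    (rho_pos h1 (by omega) (hreal i h1 h2).1) (hs.pos k (by omega))
    (hs.weight i k h1 (by omega) h3 h4) h5.le h6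

theorem head_growth {k : ℕ} (hk : k < offset ℓ A) :
    growth κ η * (p k * u (k + 1) ^ 2) ≤ p (k + 1) * u (k + 2) ^ 2 := by
  have hA1 : 1 ≤ A := by
    by_contra hc
    obtain rfl : A = 0 := by omega
    simp [offset] at hk
  obtain ⟨i, h1, h2, h3, h4⟩ := exists_offset_le ℓ hA1 (by simp [offset_one]) hk
  refine le_trans ?_ (head_growth_block hη hκ hθ hA hreal hs hu0 hu1 h1 h2 h3 h4)
  have h7 := offset_mono ℓ (show i + 1 ≤ G.g + 1 by omega)
  have := hs.pos k (by omega)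
  gcongr
  exact growth_le_rho h1 (by omega) hη (hreal i h1 h2).1

theorem head_sum_le :
    (growth κ η - 1) * ∑ k ∈ Ico 0 (offset ℓ A), p k * u (k + 1) ^ 2 ≤
      p (offset ℓ A) * u (offset ℓ A + 1) ^ 2 := by
  have := hs.pos 0 (Nat.zero_le _)
  exact sum_Ico_le_of_growth (U := fun k => p k * u (k + 1) ^ 2) (Nat.zero_le _) (by positivity)
    fun k _ hk => head_growth hη hκ hθ hA hreal hs hu0 hu1 hk

theorem head_mono : p 0 * u 1 ^ 2 ≤ p (offset ℓ A) * u (offset ℓ A + 1) ^ 2 := by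
  have h := pow_sub_mul_le (f := fun k => p k * u (k + 1) ^ 2) zero_le_one (Nat.zero_le (offset ℓ A))
    fun k _ hk => by
      refine le_trans ?_ (head_growth hη hκ hθ hA hreal hs hu0 hu1 hk)
      have h7 := offset_mono ℓ (show A ≤ G.g + 1 by omega)
      have := hs.pos k (by omega)
      gcongr
      exact (one_lt_growth hκ hη).le
  simpa using h

theorem head_prod_le (hA1 : 1 ≤ A) :
    (∏ i ∈ Ico 1 A, ((G.β i : ℝ) / G.γ i * G.rho i θ ^ 2) ^ ℓ i) * (p 0 * u 1 ^ 2) ≤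
      p (offset ℓ A) * u (offset ℓ A + 1) ^ 2 := by
  have key : ∀ j, 1 ≤ j → j ≤ A →
      (∏ i ∈ Ico 1 j, ((G.β i : ℝ) / G.γ i * G.rho i θ ^ 2) ^ ℓ i) * (p 0 * u 1 ^ 2) ≤
        p (offset ℓ j) * u (offset ℓ j + 1) ^ 2 := by
    intro j hj1
    induction j, hj1 using Nat.le_induction with
    | base => simp [offset_one]
    | succ j hj1 ih =>
      intro hjA
      have h0 : 0 ≤ (G.β j : ℝ) / G.γ j * G.rho j θ ^ 2 := by positivity
      have h := pow_sub_mul_le (f := fun k => p k * u (k + 1) ^ 2) h0 (offset_mono ℓ (Nat.le_succ j))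
        fun k hk hk' => head_growth_block hη hκ hθ hA hreal hs hu0 hu1 hj1 hjA hk hk'
      rw [offset_succ _ hj1, Nat.add_sub_cancel_left, ← offset_succ _ hj1] at h
      rw [prod_Ico_succ_top hj1]
      calc _ = ((G.β j : ℝ) / G.γ j * G.rho j θ ^ 2) ^ ℓ j *
            ((∏ i ∈ Ico 1 j, ((G.β i : ℝ) / G.γ i * G.rho i θ ^ 2) ^ ℓ i) * (p 0 * u 1 ^ 2)) := by ring
        _ ≤ ((G.β j : ℝ) / G.γ j * G.rho j θ ^ 2) ^ ℓ j * (p (offset ℓ j) * u (offset ℓ j + 1) ^ 2) := by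
          exact mul_le_mul_of_nonneg_left (ih (by omega)) (by positivity)
        _ ≤ _ := h
  exact key A hA1 le_rfl

/-- Each block costs a factor (1 - 1/q)² through `weighted_growth_le`. There are at most g blocks,
so the loss does not depend on ℓ. -/
theorem le_head_prod (hA1 : 1 ≤ A) :
    ((1 - 1 / growth κ η) ^ 2) ^ G.g * (p (offset ℓ A) * u (offset ℓ A + 1) ^ 2) ≤
      (∏ i ∈ Ico 1 A, ((G.β i : ℝ) / G.γ i * G.rho i θ ^ 2) ^ ℓ i) * (p 0 * u 1 ^ 2) := by
  have hq := one_lt_growth hκ hη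
  have hr0 : 0 ≤ 1 - 1 / growth κ η := by
    rw [sub_nonneg, div_le_one (by linarith)]
    exact hq.le
  have hr1 : 1 - 1 / growth κ η ≤ 1 := by
    have : 0 ≤ 1 / growth κ η := by positivity
    linarith
  have key : ∀ j, 1 ≤ j → j ≤ A →
      ((1 - 1 / growth κ η) ^ 2) ^ j * (p (offset ℓ j) * u (offset ℓ j + 1) ^ 2) ≤
      (∏ i ∈ Ico 1 j, ((G.β i : ℝ) / G.γ i * G.rho i θ ^ 2) ^ ℓ i) * (p 0 * u 1 ^ 2) := by
    intro j hj1
    induction j, hj1 using Nat.le_induction with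
    | base =>
      intro _
      have := hs.pos 0 (Nat.zero_le _)
      simp only [offset_one, pow_one, Ico_self, prod_empty, zero_add]
      gcongr
      exact pow_le_one₀ hr0 hr1
    | succ j hj1 ih =>
      intro hjA
      obtain ⟨h5, h6⟩ := head_start hη hκ hθ hA hreal hs hu0 hu1 hj1 hjA
      have h7 := offset_mono ℓ (show j + 1 ≤ G.g + 1 by omega)
      have h := weighted_growth_le (β_pos' hj1 (by omega)) (γ_pos' hj1 (by omega))
        (rho_pos hj1 (by omega) (hreal j hj1 hjA).1) (rho_root hj1 (by omega) hη (hreal j hj1 hjA).1)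
        hq (growth_le_rho hj1 (by omega) hη (hreal j hj1 hjA).1)
        (fun k _ hk => hs.pos k (by omega)) (fun k hk hk' => hs.weight j k hj1 (by omega) hk hk')
        (fun k hk hk' => hs.recur j k hj1 (by omega) hk hk') h5 h6 (offset_mono ℓ (Nat.le_succ j))
      rw [offset_succ _ hj1, Nat.add_sub_cancel_left, ← offset_succ _ hj1] at h
      rw [prod_Ico_succ_top hj1, pow_succ, mul_assoc]
      calc _ ≤ ((1 - 1 / growth κ η) ^ 2) ^ j * (((G.β j : ℝ) / G.γ j * G.rho j θ ^ 2) ^ ℓ j *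
            (p (offset ℓ j) * u (offset ℓ j + 1) ^ 2)) := by gcongr
        _ = ((G.β j : ℝ) / G.γ j * G.rho j θ ^ 2) ^ ℓ j *
            (((1 - 1 / growth κ η) ^ 2) ^ j * (p (offset ℓ j) * u (offset ℓ j + 1) ^ 2)) := by ring
        _ ≤ ((G.β j : ℝ) / G.γ j * G.rho j θ ^ 2) ^ ℓ j *
            ((∏ i ∈ Ico 1 j, ((G.β i : ℝ) / G.γ i * G.rho i θ ^ 2) ^ ℓ i) * (p 0 * u 1 ^ 2)) := by
          exact mul_le_mul_of_nonneg_left (ih (by omega)) (by positivity)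
        _ = _ := by ring
  refine le_trans ?_ (key A hA1 le_rfl)
  have := hs.pos (offset ℓ A) (offset_mono ℓ (by omega))
  exact mul_le_mul_of_nonneg_right
    (pow_le_pow_of_le_one (by positivity) (pow_le_one₀ hr0 hr1) hA) (by positivity)

/-- Where the head ends, `u (k + 1)` dominates `u k`. -/
theorem head_pair_le (hA2 : 2 ≤ A) :
    p (offset ℓ A) * (u (offset ℓ A) ^ 2 + u (offset ℓ A + 1) ^ 2) ≤
      (κ + 1) * (p (offset ℓ A) * u (offset ℓ A + 1) ^ 2) := by
  obtain ⟨i, rfl⟩ : ∃ i, A = i + 1 := ⟨A - 1, by omega⟩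
  obtain ⟨h5, h6⟩ := head_ratio hη hκ hθ hA hreal hs hu0 hu1 (show 1 ≤ i by omega) (by omega)
    (offset_mono ℓ (Nat.le_succ i)) le_rfl
  have h1 : 1 ≤ i := by omega
  have h2 : i ≤ G.g := by omega
  obtain ⟨hr, -⟩ := hreal i h1 (by omega)
  have h7 := growth_le_rho h1 h2 hη hr
  have h8 := one_lt_growth hκ hη
  have h9 := rho_pos h1 h2 hr
  -- Growth gives (β_i / γ_i) ρ_i² ≥ 1, and β_i / γ_i ≤ κ.
  have h10 : 1 ≤ κ * G.rho i θ ^ 2 := by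
    have h11 : (G.β i : ℝ) / G.γ i ≤ κ :=
      (div_le_self (by positivity) (G.one_le_γ h1 (by omega))).trans (G.β_le h1 (by omega))
    calc (1 : ℝ) ≤ (G.β i : ℝ) / G.γ i * G.rho i θ ^ 2 := by linarith
      _ ≤ _ := by gcongr
  have h12 : u (offset ℓ (i + 1)) ^ 2 ≤ κ * u (offset ℓ (i + 1) + 1) ^ 2 := by
    calc _ ≤ κ * G.rho i θ ^ 2 * u (offset ℓ (i + 1)) ^ 2 := le_mul_of_one_le_left (sq_nonneg _) h10
      _ = κ * (G.rho i θ * u (offset ℓ (i + 1))) ^ 2 := by ring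
      _ ≤ _ := by gcongr
  have := hs.pos (offset ℓ (i + 1)) (offset_mono ℓ (by omega))
  calc _ ≤ p (offset ℓ (i + 1)) * (κ * u (offset ℓ (i + 1) + 1) ^ 2 + u (offset ℓ (i + 1) + 1) ^ 2) := by
        gcongr
    _ = _ := by ring

end Head

end GraphicalSeq

namespace GraphicalSeq

variable {κ lam : ℕ} {G : GraphicalSeq κ lam} {ℓ : ℕ → ℕ} {θ η : ℝ} {p u : ℕ → ℝ}

/-! ### Blocks with real characteristic roots at the end -/

section Tail

variable {B : ℕ} (hη : 0 < η) (hκ : 0 < κ) (hθ : θ < κ) (hB1 : 1 ≤ B) (hB : B < G.g)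
  (hreal : ∀ i, B < i → i ≤ G.g → G.RealBlock η θ i ∧ (G.β i : ℝ) < G.γ i)
  (hs : G.IsSolution ℓ θ p u) (hu : 0 ≤ u (offset ℓ (G.g + 1) + 1))
  (hlast : G.γ (G.g + 1) * u (offset ℓ (G.g + 1)) =
    (θ - G.α (G.g + 1)) * u (offset ℓ (G.g + 1) + 1))
include hη hθ hB1 hB hreal hs hu hlast

omit hs in
theorem tail_ratio_end :
    G.tau G.g θ * u (offset ℓ (G.g + 1) + 1) ≤ u (offset ℓ (G.g + 1)) := by
  obtain ⟨h3, h4⟩ := hreal G.g hB le_rfl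
  have h := γ_mul_tau_le (by omega) hη h3 hθ h4
  have hγ : (0 : ℝ) < G.γ (G.g + 1) := zero_lt_one.trans_le (G.one_le_γ (by omega) le_rfl)
  refine le_of_mul_le_mul_left ?_ hγ
  rw [hlast, ← mul_assoc]
  gcongr

/-- Downward induction from block g: since τ_i ≤ τ_{i+1}, the bound at the start of block i + 1 is
stronger than the one needed at the end of block i. -/
theorem tail_ratio {i : ℕ} (h1 : B < i) (h2 : i ≤ G.g) :
    ∀ k, offset ℓ i ≤ k → k ≤ offset ℓ (i + 1) → 0 ≤ u (k + 1) ∧ G.tau i θ * u (k + 1) ≤ u k := by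
  have hblock : ∀ i, B < i → i ≤ G.g → 0 ≤ u (offset ℓ (i + 1) + 1) →
      G.tau i θ * u (offset ℓ (i + 1) + 1) ≤ u (offset ℓ (i + 1)) →
      ∀ k, offset ℓ i ≤ k → k ≤ offset ℓ (i + 1) → 0 ≤ u (k + 1) ∧ G.tau i θ * u (k + 1) ≤ u k :=
    fun i h1 h2 h3 h4 k hk hk' =>
      ratio_le_of_recur' (β_pos' (by omega) h2).le (γ_pos' (by omega) h2)
        (tau_pos (by omega) h2 (hreal i h1 h2).1) (tau_root (by omega) h2 hη (hreal i h1 h2).1)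
        (fun k hk hk' => hs.recur i k (by omega) h2 hk hk') h3 h4 hk hk'
  induction h2 using Nat.decreasingInduction with
  | self => exact hblock _ hB le_rfl hu (tail_ratio_end hη hθ hB1 hB hreal hu hlast)
  | of_succ i h2 ih =>
    obtain ⟨h3, h4⟩ := ih (by omega) _ le_rfl (offset_mono ℓ (Nat.le_succ (i + 1)))
    refine hblock i h1 h2.le h3 (le_trans ?_ h4)
    have := tau_le_succ (by omega) h2 hη (hreal i h1 h2.le).1 (hreal (i + 1) (by omega) h2).1 hθ
      (hreal i h1 h2.le).2
    gcongr

/-- Mirror image of `head_growth`: read backwards, the weight ratio is γ_i / β_i, and the natural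
terms are p_k u_k² instead of p_k u_{k+1}². -/
theorem tail_decay {k : ℕ} (hk : offset ℓ (B + 1) ≤ k) (hk' : k < offset ℓ (G.g + 1)) :
    growth κ η * (p (k + 1) * u (k + 1) ^ 2) ≤ p k * u k ^ 2 := by
  obtain ⟨i, h1, h2, h3, h4⟩ := exists_offset_le ℓ (show B + 1 ≤ G.g + 1 by omega) hk hk'
  obtain ⟨h5, h6⟩ := tail_ratio hη hθ hB1 hB hreal hs hu hlast h1 (by omega) k h3 h4.le
  have h7 := (hreal i h1 (by omega)).1
  have h8 := growth_le_tau (by omega) (by omega) hη h7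
  have h9 := tau_pos (by omega) (by omega) h7
  have h10 := hs.weight i k (by omega) (by omega) h3 h4
  have hβ := β_pos' (G := G) (i := i) (by omega) (by omega)
  have hγ := γ_pos' (G := G) (i := i) (by omega) (by omega)
  have h11 : p k = p (k + 1) * G.γ i / G.β i := by field_simp; linarith
  have hp := hs.pos (k + 1) hk'
  calc growth κ η * (p (k + 1) * u (k + 1) ^ 2) ≤
      (G.γ i : ℝ) / G.β i * G.tau i θ ^ 2 * (p (k + 1) * u (k + 1) ^ 2) := by gcongr
    _ = p (k + 1) * G.γ i / G.β i * (G.tau i θ * u (k + 1)) ^ 2 := by ring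
    _ ≤ p (k + 1) * G.γ i / G.β i * u k ^ 2 := by gcongr
    _ = _ := by rw [h11]

include hκ

theorem tail_sum_le :
    ∑ k ∈ Ico (offset ℓ (B + 1)) (offset ℓ (G.g + 1) + 1), p k * u (k + 1) ^ 2 ≤
      (κ + κ / (growth κ η - 1)) * (p (offset ℓ (B + 1)) * u (offset ℓ (B + 1)) ^ 2) := by
  have hq := one_lt_growth hκ hη
  have hmn := offset_mono ℓ (show B + 1 ≤ G.g + 1 by omega)
  have hpm := hs.pos _ hmn
  have hpn := hs.pos _ le_rfl
  have hsum := sum_Ico_le_of_decay (V := fun k => p k * u k ^ 2) hmn (by positivity)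
    fun k hk hk' => tail_decay hη hθ hB1 hB hreal hs hu hlast hk hk'
  -- Monotonicity of p_k u_k², obtained with factor 1 for the negated sequence.
  have hmono := le_pow_sub_mul' (f := fun k => -(p k * u k ^ 2)) zero_le_one hmn
    fun k hk hk' => by
      have h := tail_decay hη hθ hB1 hB hreal hs hu hlast hk hk'
      have := hs.pos (k + 1) hk'
      have h2 : 1 * (p (k + 1) * u (k + 1) ^ 2) ≤ growth κ η * (p (k + 1) * u (k + 1) ^ 2) := by
        gcongr
      linarith
  rw [one_pow, one_mul, neg_le_neg_iff] at hmono
  -- Replacing p_k by p_{k+1} costs a factor γ_i / β_i ≤ κ.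
  have h1 : ∑ k ∈ Ico (offset ℓ (B + 1)) (offset ℓ (G.g + 1)), p k * u (k + 1) ^ 2 ≤
      κ * ∑ k ∈ Ico (offset ℓ (B + 1)) (offset ℓ (G.g + 1)), p (k + 1) * u (k + 1) ^ 2 := by
    rw [mul_sum]
    refine sum_le_sum fun k hk => ?_
    rw [mem_Ico] at hk
    obtain ⟨i, h1, h2, h3, h4⟩ := exists_offset_le ℓ (show B + 1 ≤ G.g + 1 by omega) hk.1 hk.2
    have h5 := hs.weight i k (by omega) (by omega) h3 h4
    have h6 := G.one_le_β (show 1 ≤ i by omega) (by omega)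
    have h7 := G.γ_le (show 1 ≤ i by omega) (by omega)
    have h8 := hs.pos (k + 1) hk.2
    have h9 := hs.pos k hk.2.le
    have h10 : p k ≤ κ * p (k + 1) := by nlinarith
    calc p k * u (k + 1) ^ 2 ≤ κ * p (k + 1) * u (k + 1) ^ 2 := by gcongr
      _ = _ := by ring
  -- The last index lies in block g + 1, outside the weight relation; it is controlled by the
  -- boundary ratio, with τ_g² ≥ 1 / κ.
  have h2 : u (offset ℓ (G.g + 1) + 1) ^ 2 ≤ κ * u (offset ℓ (G.g + 1)) ^ 2 := by
    have hr := (hreal G.g hB le_rfl).1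
    have h3 := tail_ratio_end hη hθ hB1 hB hreal hu hlast
    have h4 := growth_le_tau (by omega) le_rfl hη hr
    have h5 := tau_pos (by omega) le_rfl hr
    have h10 : 1 ≤ κ * G.tau G.g θ ^ 2 := by
      have h11 : (G.γ G.g : ℝ) / G.β G.g ≤ κ :=
        (div_le_self (by positivity) (G.one_le_β (by omega) le_rfl)).trans (G.γ_le (by omega) (by omega))
      calc (1 : ℝ) ≤ (G.γ G.g : ℝ) / G.β G.g * G.tau G.g θ ^ 2 := by linarith
        _ ≤ _ := by gcongr
    calc _ ≤ κ * G.tau G.g θ ^ 2 * u (offset ℓ (G.g + 1) + 1) ^ 2 :=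
          le_mul_of_one_le_left (sq_nonneg _) h10
      _ = κ * (G.tau G.g θ * u (offset ℓ (G.g + 1) + 1)) ^ 2 := by ring
      _ ≤ _ := by gcongr
  rw [sum_Ico_succ_top hmn]
  have h3 : ∑ k ∈ Ico (offset ℓ (B + 1)) (offset ℓ (G.g + 1)), p (k + 1) * u (k + 1) ^ 2 ≤
      p (offset ℓ (B + 1)) * u (offset ℓ (B + 1)) ^ 2 / (growth κ η - 1) := by
    rw [le_div_iff₀ (by linarith), mul_comm]
    exact hsum
  calc _ ≤ κ * (p (offset ℓ (B + 1)) * u (offset ℓ (B + 1)) ^ 2 / (growth κ η - 1)) +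
        p (offset ℓ (G.g + 1)) * (κ * u (offset ℓ (G.g + 1)) ^ 2) := by
        gcongr
        exact h1.trans (by gcongr)
    _ = κ * (p (offset ℓ (B + 1)) * u (offset ℓ (B + 1)) ^ 2 / (growth κ η - 1)) +
        κ * (p (offset ℓ (G.g + 1)) * u (offset ℓ (G.g + 1)) ^ 2) := by ring
    _ ≤ κ * (p (offset ℓ (B + 1)) * u (offset ℓ (B + 1)) ^ 2 / (growth κ η - 1)) +
        κ * (p (offset ℓ (B + 1)) * u (offset ℓ (B + 1)) ^ 2) := by gcongr
    _ = _ := by ring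

end Tail

theorem IsSolution.neg (hs : G.IsSolution ℓ θ p u) : G.IsSolution ℓ θ p fun k => -u k where
  pos := hs.pos
  weight := hs.weight
  recur i k h1 h2 h3 h4 := by linarith [hs.recur i k h1 h2 h3 h4]

/-- `p k` times the squared length of `(u k, u (k + 1))`. -/
def pairWeight (p u : ℕ → ℝ) (k : ℕ) : ℝ := p k * (u k ^ 2 + u (k + 1) ^ 2)

theorem IsSolution.pairWeight_nonneg (hs : G.IsSolution ℓ θ p u) {k : ℕ} (hk : k ≤ offset ℓ (G.g + 1)) :
    0 ≤ pairWeight p u k :=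
  mul_nonneg (hs.pos k hk).le (by positivity)

theorem IsSolution.mul_sq_le_pairWeight (hs : G.IsSolution ℓ θ p u) {k : ℕ} (hk : k ≤ offset ℓ (G.g + 1)) :
    p k * u (k + 1) ^ 2 ≤ pairWeight p u k :=
  mul_le_mul_of_nonneg_left (le_add_of_nonneg_left (sq_nonneg _)) (hs.pos k hk).le

/-- If B = g the sum is a single term. Otherwise u may be replaced by -u to make the last value
nonnegative. -/
theorem tail_sum_le_pairWeight {B : ℕ} (hη : 0 < η) (hκ : 0 < κ) (hθ : θ < κ) (hB1 : 1 ≤ B) (hB : B ≤ G.g)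
    (hreal : ∀ i, B < i → i ≤ G.g → G.RealBlock η θ i ∧ (G.β i : ℝ) < G.γ i)
    (hs : G.IsSolution ℓ θ p u)
    (hlast : G.γ (G.g + 1) * u (offset ℓ (G.g + 1)) =
      (θ - G.α (G.g + 1)) * u (offset ℓ (G.g + 1) + 1) ∨ B = G.g) :
    ∑ k ∈ Ico (offset ℓ (B + 1)) (offset ℓ (G.g + 1) + 1), p k * u (k + 1) ^ 2 ≤
      (κ + κ / (growth κ η - 1)) * pairWeight p u (offset ℓ (B + 1)) := by
  have hq := one_lt_growth hκ hη
  have hq' : 0 ≤ κ / (growth κ η - 1) := div_nonneg (by positivity) (by linarith)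
  have hmn := offset_mono ℓ (show B + 1 ≤ G.g + 1 by omega)
  rcases eq_or_ne B G.g with rfl | hne
  · rw [sum_Ico_succ_top le_rfl, Ico_self, sum_empty, zero_add]
    have h1 : (1 : ℝ) ≤ κ := by exact_mod_cast hκ
    exact (hs.mul_sq_le_pairWeight le_rfl).trans
      (le_mul_of_one_le_left (hs.pairWeight_nonneg le_rfl) (by linarith))
  · have hlast := hlast.resolve_right hne
    have h1 : p (offset ℓ (B + 1)) * u (offset ℓ (B + 1)) ^ 2 ≤ pairWeight p u (offset ℓ (B + 1)) :=
      mul_le_mul_of_nonneg_left (le_add_of_nonneg_right (sq_nonneg _)) (hs.pos _ hmn).le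
    refine le_trans ?_ (mul_le_mul_of_nonneg_left h1 (by positivity))
    rcases le_total 0 (u (offset ℓ (G.g + 1) + 1)) with hu | hu
    · exact tail_sum_le hη hκ hθ hB1 (by omega) hreal hs hu hlast
    · have h2 := tail_sum_le hη hκ hθ hB1 (by omega) hreal hs.neg (neg_nonneg.2 hu)
        (by linarith)
      simpa only [neg_sq] using h2

/-! ### The middle blocks -/

section Middle

variable (hκ : 0 < κ) (h0 : 0 ≤ θ) (hθ : θ < κ) (hs : G.IsSolution ℓ θ p u)
include h0 hθ hs

/-- `weight_step_le` for the recurrence and for its reversal. No information on the roots is used,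
so this is available in the gap. -/
theorem pairWeight_succ_le {k : ℕ} (hk : k < offset ℓ (G.g + 1)) :
    pairWeight p u (k + 1) ≤ 9 * (κ : ℝ) ^ 4 * pairWeight p u k ∧
    pairWeight p u k ≤ 9 * (κ : ℝ) ^ 4 * pairWeight p u (k + 1) := by
  obtain ⟨i, h1, h2, h3, h4⟩ := exists_offset_le ℓ (show 1 ≤ G.g + 1 by omega) (by simp [offset_one]) hk
  have h5 := hs.weight i k h1 (by omega) h3 h4
  have h6 := hs.recur i k h1 (by omega) h3 h4
  have hb := G.one_le_β h1 (show i ≤ G.g by omega)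
  have hc := G.one_le_γ h1 h2.le
  have he := G.abs_α_sub_le h0 hθ.le h1 h2.le
  have h7 := weight_step_le hb (G.β_le h1 h2.le) hc (G.γ_le h1 h2.le) he h6
  have h8 := weight_step_le (u₀ := u (k + 2)) (u₁ := u (k + 1)) (u₂ := u k) hc (G.γ_le h1 h2.le) hb
    (G.β_le h1 h2.le) he (by linarith)
  have hp := hs.pos k hk.le
  have hP : 0 ≤ p k / G.γ i := by positivity
  have h9 : p (k + 1) = p k / G.γ i * G.β i := by field_simp; linarith
  have h10 : p k = p k / G.γ i * G.γ i := by field_simp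
  unfold pairWeight
  constructor
  · calc _ = p k / G.γ i * (G.β i * (u (k + 1) ^ 2 + u (k + 2) ^ 2)) := by rw [h9]; ring
      _ ≤ p k / G.γ i * (9 * (κ : ℝ) ^ 4 * (G.γ i * (u k ^ 2 + u (k + 1) ^ 2))) := by gcongr
      _ = 9 * (κ : ℝ) ^ 4 * ((p k / G.γ i * G.γ i) * (u k ^ 2 + u (k + 1) ^ 2)) := by ring
      _ = _ := by rw [← h10]
  · calc _ = (p k / G.γ i * G.γ i) * (u k ^ 2 + u (k + 1) ^ 2) := by rw [← h10]
      _ = p k / G.γ i * (G.γ i * (u (k + 1) ^ 2 + u k ^ 2)) := by ring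
      _ ≤ p k / G.γ i * (9 * (κ : ℝ) ^ 4 * (G.β i * (u (k + 2) ^ 2 + u (k + 1) ^ 2))) := by gcongr
      _ = 9 * (κ : ℝ) ^ 4 * (p k / G.γ i * G.β i * (u (k + 1) ^ 2 + u (k + 2) ^ 2)) := by ring
      _ = _ := by rw [← h9]

theorem pairWeight_le_pow {k n : ℕ} (hkn : k ≤ n) (hn : n ≤ offset ℓ (G.g + 1)) :
    pairWeight p u n ≤ (9 * (κ : ℝ) ^ 4) ^ (n - k) * pairWeight p u k ∧
    pairWeight p u k ≤ (9 * (κ : ℝ) ^ 4) ^ (n - k) * pairWeight p u n :=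
  ⟨le_pow_sub_mul (by positivity) hkn fun j _ hj => (pairWeight_succ_le h0 hθ hs (by omega)).1,
    le_pow_sub_mul' (by positivity) hkn fun j _ hj => (pairWeight_succ_le h0 hθ hs (by omega)).2⟩

variable (hη : 0 < η)
include hκ hη

/-- The energy lies between η / (8κ) and 2κ times the squared length of the pair, and p times the
energy is constant, so 16κ² / η is the cost. The summand 1 makes the constant at least 1, so that
its powers increase. -/
theorem pairWeight_block_le {i j k : ℕ} (h1 : 1 ≤ i) (h2 : i ≤ G.g) (hi : G.ComplexBlock η θ i)
    (hj : offset ℓ i ≤ j) (hj' : j ≤ offset ℓ (i + 1)) (hk : offset ℓ i ≤ k) (hk' : k ≤ offset ℓ (i + 1)) :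
    pairWeight p u k ≤ (1 + 16 * (κ : ℝ) ^ 2 / η) * pairWeight p u j := by
  have hb := β_pos' h1 h2
  have hc := γ_pos' h1 h2
  have he := G.abs_α_sub_le h0 hθ.le h1 (show i ≤ G.g + 1 by omega)
  have hen : ∀ {k}, offset ℓ i ≤ k → k ≤ offset ℓ (i + 1) → _ := fun {k} hk hk' =>
    weighted_energy_const (k := k) hb hc (fun k hk hk' => hs.weight i k h1 h2 hk hk')
      (fun k hk hk' => hs.recur i k h1 h2 hk hk') hk hk'
  have h3 := le_energy hb (G.β_le h1 (by omega)) (G.γ_le h1 (by omega)) hη hi (u k) (u (k + 1))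
  have h4 := energy_le hb.le (G.β_le h1 (by omega)) (G.γ_le h1 (by omega)) he (u j) (u (j + 1))
  have h5 := (hen hk hk').trans (hen hj hj').symm
  have h6 := offset_mono ℓ (show i + 1 ≤ G.g + 1 by omega)
  have hpj := hs.pos j (by omega)
  have hpk := hs.pos k (by omega)
  have h7 : η * pairWeight p u k ≤ 16 * (κ : ℝ) ^ 2 * pairWeight p u j := by
    unfold pairWeight
    calc _ = p k * (η * (u k ^ 2 + u (k + 1) ^ 2)) := by ring
      _ ≤ p k * (8 * κ * energy (G.β i) (G.α i - θ) (G.γ i) (u k) (u (k + 1))) := by gcongr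
      _ = 8 * κ * (p k * energy (G.β i) (G.α i - θ) (G.γ i) (u k) (u (k + 1))) := by ring
      _ = 8 * κ * (p j * energy (G.β i) (G.α i - θ) (G.γ i) (u j) (u (j + 1))) := by rw [h5]
      _ ≤ 8 * κ * (p j * (2 * κ * (u j ^ 2 + u (j + 1) ^ 2))) := by gcongr
      _ = _ := by ring
  have h8 : pairWeight p u k ≤ 16 * (κ : ℝ) ^ 2 / η * pairWeight p u j := by
    rw [div_mul_eq_mul_div, le_div_iff₀ hη]
    linarith
  linarith [hs.pairWeight_nonneg (show j ≤ offset ℓ (G.g + 1) by omega)]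

theorem pairWeight_complex_le {m n : ℕ} (hm : 1 ≤ m) (hmn : m ≤ n) (hn : n ≤ G.g + 1)
    (hell : ∀ i, m ≤ i → i < n → G.ComplexBlock η θ i) {k : ℕ} (hk : offset ℓ m ≤ k)
    (hk' : k ≤ offset ℓ n) :
    pairWeight p u k ≤ (1 + 16 * (κ : ℝ) ^ 2 / η) ^ G.g * pairWeight p u (offset ℓ m) ∧
    pairWeight p u (offset ℓ m) ≤ (1 + 16 * (κ : ℝ) ^ 2 / η) ^ G.g * pairWeight p u k := by
  set C := 1 + 16 * (κ : ℝ) ^ 2 / η with hC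
  have hC1 : 1 ≤ C := le_add_of_nonneg_right (by positivity)
  have hnn : ∀ k, k ≤ offset ℓ n → 0 ≤ pairWeight p u k := fun k hk =>
    hs.pairWeight_nonneg (hk.trans (offset_mono ℓ hn))
  have key : ∀ n', m ≤ n' → n' ≤ n → ∀ k, offset ℓ m ≤ k → k ≤ offset ℓ n' →
      pairWeight p u k ≤ C ^ (n' - m) * pairWeight p u (offset ℓ m) ∧
      pairWeight p u (offset ℓ m) ≤ C ^ (n' - m) * pairWeight p u k := by
    intro n' hn'
    induction n', hn' using Nat.le_induction with
    | base =>
      intro _ k hk hk'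
      obtain rfl : k = offset ℓ m := by omega
      simp
    | succ i hmi ih =>
      intro hi k hk hk'
      rw [Nat.succ_sub hmi, pow_succ]
      have hoi := offset_mono ℓ (Nat.le_succ i)
      have hon := offset_mono ℓ hi
      have h2 := hnn _ (offset_mono ℓ hmn)
      have hkn := hnn k (by omega)
      rcases le_total k (offset ℓ i) with hki | hki
      · obtain ⟨h3, h4⟩ := ih (by omega) k hk hki
        have hC2 : C ^ (i - m) ≤ C ^ (i - m) * C := le_mul_of_one_le_right (by positivity) hC1
        exact ⟨h3.trans (by gcongr), h4.trans (by gcongr)⟩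
      · obtain ⟨h3, h4⟩ := ih (by omega) _ (offset_mono ℓ hmi) le_rfl
        have h5 := pairWeight_block_le hκ h0 hθ hs hη (by omega) (by omega) (hell i hmi hi)
          le_rfl hoi hki hk'
        have h6 := pairWeight_block_le hκ h0 hθ hs hη (by omega) (by omega) (hell i hmi hi)
          hki hk' le_rfl hoi
        constructor
        · calc _ ≤ C * pairWeight p u (offset ℓ i) := h5
            _ ≤ C * (C ^ (i - m) * pairWeight p u (offset ℓ m)) := by gcongr
            _ = _ := by ring
        · calc _ ≤ C ^ (i - m) * pairWeight p u (offset ℓ i) := h4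
            _ ≤ C ^ (i - m) * (C * pairWeight p u k) := by gcongr
            _ = _ := by ring
  replace key := key n hmn le_rfl k hk hk'
  have hpow : C ^ (n - m) ≤ C ^ G.g := pow_le_pow_right₀ hC1 (by omega)
  have h1 := hnn k hk'
  have h2 := hnn _ (offset_mono ℓ hmn)
  exact ⟨key.1.trans (by gcongr), key.2.trans (by gcongr)⟩

/-- The estimates over the blocks `a ≤ i < b` if those with `a ≤ i < m` or `n ≤ i < b` have complex
characteristic roots. -/
theorem middle_estimates {a m n b : ℕ} (ha : 1 ≤ a) (ham : a ≤ m) (hmn : m ≤ n) (hnb : n ≤ b)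
    (hb : b ≤ G.g + 1) (h1 : ∀ i, a ≤ i → i < m → G.ComplexBlock η θ i)
    (h2 : ∀ i, n ≤ i → i < b → G.ComplexBlock η θ i) {k : ℕ} :
    (offset ℓ a ≤ k → k ≤ offset ℓ m →
      pairWeight p u k ≤ (1 + 16 * (κ : ℝ) ^ 2 / η) ^ G.g * pairWeight p u (offset ℓ a) ∧
      pairWeight p u (offset ℓ a) ≤ (1 + 16 * (κ : ℝ) ^ 2 / η) ^ G.g * pairWeight p u k) ∧
    (offset ℓ m ≤ k → k ≤ offset ℓ n →
      pairWeight p u k ≤ (9 * (κ : ℝ) ^ 4) ^ (k - offset ℓ m) *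
        ((1 + 16 * (κ : ℝ) ^ 2 / η) ^ G.g * pairWeight p u (offset ℓ a))) ∧
    (offset ℓ n ≤ k → k ≤ offset ℓ b →
      pairWeight p u k ≤ ((1 + 16 * (κ : ℝ) ^ 2 / η) ^ G.g) ^ 2 *
        (9 * (κ : ℝ) ^ 4) ^ (offset ℓ n - offset ℓ m) * pairWeight p u (offset ℓ a) ∧
      pairWeight p u (offset ℓ a) ≤ ((1 + 16 * (κ : ℝ) ^ 2 / η) ^ G.g) ^ 2 *
        (9 * (κ : ℝ) ^ 4) ^ (offset ℓ n - offset ℓ m) * pairWeight p u k) := by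
  have hon := offset_mono ℓ (hnb.trans hb)
  have hm := pairWeight_complex_le hκ h0 hθ hs hη ha ham (by omega) h1 (offset_mono ℓ ham) le_rfl
  have hn := pairWeight_le_pow h0 hθ hs (offset_mono ℓ hmn) hon
  refine ⟨fun hk hk' => pairWeight_complex_le hκ h0 hθ hs hη ha ham (by omega) h1 hk hk',
    fun hk hk' => ?_, fun hk hk' => ?_⟩
  · exact ((pairWeight_le_pow h0 hθ hs hk (hk'.trans hon)).1).trans
      (mul_le_mul_of_nonneg_left hm.1 (by positivity))
  · have hc := pairWeight_complex_le hκ h0 hθ hs hη (by omega) hnb hb h2 hk hk'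
    set M := (1 + 16 * (κ : ℝ) ^ 2 / η) ^ G.g
    have hM : 0 ≤ M := by positivity
    constructor
    · calc _ ≤ M * pairWeight p u (offset ℓ n) := hc.1
        _ ≤ M * ((9 * (κ : ℝ) ^ 4) ^ (offset ℓ n - offset ℓ m) * (M * pairWeight p u (offset ℓ a))) := by
          gcongr
          exact hn.1.trans (mul_le_mul_of_nonneg_left hm.1 (by positivity))
        _ = _ := by ring
    · calc _ ≤ M * pairWeight p u (offset ℓ m) := hm.2
        _ ≤ M * ((9 * (κ : ℝ) ^ 4) ^ (offset ℓ n - offset ℓ m) * (M * pairWeight p u k)) := by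
          gcongr
          exact hn.2.trans (mul_le_mul_of_nonneg_left hc.2 (by positivity))
        _ = _ := by ring

end Middle

end GraphicalSeq

namespace GraphicalSeq

variable {κ lam : ℕ} {G : GraphicalSeq κ lam} {ℓ : ℕ → ℕ} {θ η lo hi : ℝ} {p u : ℕ → ℝ}

/-! ### Summation over the middle range and passage to the Christoffel sum -/

theorem sum_pow_range_le {x : ℝ} (hx : 2 ≤ x) (n : ℕ) : ∑ i ∈ range n, x ^ i ≤ x ^ n := by
  induction n with
  | zero => simp
  | succ n ih =>
    rw [sum_range_succ, pow_succ]
    nlinarith [pow_pos (show 0 < x by linarith) n]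

/-- N is the weight of the pair at the start of the middle range. Outside [m, n) each term is
comparable with N. The terms in [m, n) form a geometric sum of the size of one further term; as a <
m, this is absorbed by doubling the number of terms outside. -/
theorem middle_sum_bounds {a m n b : ℕ} {M K N : ℝ} {W : ℕ → ℝ} {t : ℕ}
    (ham : a < m) (hmn : m ≤ n) (hnb : n ≤ b) (hbt : b ≤ t) (hM : 1 ≤ M) (hK : 2 ≤ K) (hN : 0 ≤ N)
    (hW : ∀ k, k ≤ t → 0 ≤ W k)
    (h1 : ∀ k, a ≤ k → k ≤ m → W k ≤ M * N ∧ N ≤ M * W k)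
    (h2 : ∀ k, m ≤ k → k ≤ n → W k ≤ K ^ (k - m) * (M * N))
    (h3 : ∀ k, n ≤ k → k ≤ b → W k ≤ M ^ 2 * K ^ (n - m) * N ∧ N ≤ M ^ 2 * K ^ (n - m) * W k) :
    ((m - a + (b - n) : ℕ) : ℝ) * N ≤ M ^ 2 * K ^ (n - m) * ∑ k ∈ range (t + 1), W k ∧
    ∑ k ∈ Ico a b, W k ≤ 2 * ((m - a + (b - n) : ℕ) : ℝ) * (M ^ 2 * K ^ (n - m)) * N := by
  have hK1 : 1 ≤ K ^ (n - m) := one_le_pow₀ (by linarith)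
  have hM2 : M ≤ M ^ 2 := by nlinarith
  have hMK : M ≤ M ^ 2 * K ^ (n - m) := hM2.trans (le_mul_of_one_le_right (by positivity) hK1)
  have hM0 : 0 ≤ M := by linarith
  constructor
  · have hdisj : Disjoint (Ico a m) (Ico n b) := by
      rw [Finset.disjoint_left]
      intro k hk hk'
      rw [mem_Ico] at hk hk'
      omega
    have hsub : Ico a m ∪ Ico n b ⊆ range (t + 1) := by
      intro k hk
      rw [mem_union, mem_Ico, mem_Ico] at hk
      rw [mem_range]
      omega
    have h4 : ∑ k ∈ Ico a m ∪ Ico n b, W k ≤ ∑ k ∈ range (t + 1), W k :=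
      sum_le_sum_of_subset_of_nonneg hsub fun k hk _ => hW k (Nat.lt_succ_iff.1 (mem_range.1 hk))
    have h5 : ∑ _k ∈ Ico a m ∪ Ico n b, N ≤ ∑ k ∈ Ico a m ∪ Ico n b, M ^ 2 * K ^ (n - m) * W k := by
      refine sum_le_sum fun k hk => ?_
      rw [mem_union, mem_Ico, mem_Ico] at hk
      rcases hk with hk | hk
      · refine (h1 k hk.1 hk.2.le).2.trans ?_
        have := hW k (by omega)
        gcongr
      · exact (h3 k hk.1 hk.2.le).2
    rw [sum_const, card_union_of_disjoint hdisj, Nat.card_Ico, Nat.card_Ico, nsmul_eq_mul, ← mul_sum] at h5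
    exact h5.trans (by gcongr)
  · rw [← sum_Ico_consecutive _ ham.le (hmn.trans hnb), ← sum_Ico_consecutive _ hmn hnb]
    have h4 : ∑ k ∈ Ico a m, W k ≤ ((m - a : ℕ) : ℝ) * (M ^ 2 * K ^ (n - m) * N) := by
      rw [← nsmul_eq_mul, ← Nat.card_Ico]
      refine sum_le_card_nsmul _ _ _ fun k hk => ?_
      rw [mem_Ico] at hk
      exact (h1 k hk.1 hk.2.le).1.trans (by gcongr)
    have h5 : ∑ k ∈ Ico n b, W k ≤ ((b - n : ℕ) : ℝ) * (M ^ 2 * K ^ (n - m) * N) := by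
      rw [← nsmul_eq_mul, ← Nat.card_Ico]
      refine sum_le_card_nsmul _ _ _ fun k hk => ?_
      rw [mem_Ico] at hk
      exact (h3 k hk.1 hk.2.le).1
    have h6 : ∑ k ∈ Ico m n, W k ≤ M ^ 2 * K ^ (n - m) * N := by
      rw [sum_Ico_eq_sum_range]
      calc _ ≤ ∑ k ∈ range (n - m), K ^ k * (M * N) := by
            refine sum_le_sum fun k hk => ?_
            rw [mem_range] at hk
            simpa using h2 (m + k) (by omega) (by omega)
        _ = (∑ k ∈ range (n - m), K ^ k) * (M * N) := by rw [sum_mul]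
        _ ≤ K ^ (n - m) * (M ^ 2 * N) := by
            gcongr
            exact sum_pow_range_le hK _
        _ = _ := by ring
    have h7 : (1 : ℝ) ≤ ((m - a : ℕ) : ℝ) := by exact_mod_cast (show 1 ≤ m - a by omega)
    have h8 : (0 : ℝ) ≤ ((b - n : ℕ) : ℝ) := by positivity
    have h9 : 0 ≤ M ^ 2 * K ^ (n - m) * N := by positivity
    push_cast
    nlinarith [mul_nonneg (sub_nonneg.2 h7) h9, mul_nonneg h8 h9]

theorem christoffelSum_eq (G : GraphicalSeq κ lam) (ℓ : ℕ → ℕ) (θ : ℝ) :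
    G.christoffelSum ℓ θ = 1 + ∑ k ∈ range (offset ℓ (G.g + 1) + 1), G.kap ℓ (k + 1) * G.u ℓ (k + 1) θ ^ 2 := by
  rw [christoffelSum, diam_eq, sum_range_succ', add_comm]
  simp [kap_zero, u_zero]

theorem christoffelSum_le (hℓ : G.Lengths ℓ) (hκ : 0 < κ) (θ : ℝ) :
    G.christoffelSum ℓ θ ≤ 1 + ∑ k ∈ range (offset ℓ (G.g + 1) + 1),
      G.kap ℓ (k + 1) * G.c ℓ (k + 1) * G.u ℓ (k + 1) θ ^ 2 := by
  rw [christoffelSum_eq]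
  gcongr with k hk
  rw [mem_range] at hk
  exact le_mul_of_one_le_right (kap_pos hℓ hκ (by omega)).le (hℓ.one_le_c (by omega))

theorem b_le (hℓ : G.Lengths ℓ) {k : ℕ} (hk : k ≤ offset ℓ (G.g + 1) + 1) : G.b ℓ k ≤ κ := by
  rcases k with _ | k
  · simp [b]
  obtain ⟨i, h1, h2, h3, h4⟩ := hℓ.exists_block (show k ≤ offset ℓ (G.g + 1) by omega)
  rw [G.b_succ ℓ h1 h2 h3 h4]
  exact G.β_le h1 h2

/-- By detailed balance the pair weight at k is κ_k b_k u_k² + κ_{k+1} c_{k+1} u_{k+1}², so each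
term κ_k u_k² is counted at most twice, with a factor of at most κ. -/
theorem sum_pairWeight_le (hℓ : G.Lengths ℓ) (hκ : 0 < κ) (θ : ℝ) :
    ∑ k ∈ range (offset ℓ (G.g + 1) + 1),
      pairWeight (fun k => G.kap ℓ (k + 1) * G.c ℓ (k + 1)) (fun k => G.u ℓ k θ) k ≤
        2 * κ * G.christoffelSum ℓ θ := by
  set f : ℕ → ℝ := fun k => G.kap ℓ k * G.u ℓ k θ ^ 2 with hf
  have hf0 : ∀ k, k ≤ offset ℓ (G.g + 1) + 1 → 0 ≤ f k := fun k hk => by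
    have := kap_pos hℓ hκ hk
    positivity
  have h1 : ∑ k ∈ range (offset ℓ (G.g + 1) + 1),
      pairWeight (fun k => G.kap ℓ (k + 1) * G.c ℓ (k + 1)) (fun k => G.u ℓ k θ) k ≤
      ∑ k ∈ range (offset ℓ (G.g + 1) + 1), (κ * f k + κ * f (k + 1)) := by
    refine sum_le_sum fun k hk => ?_
    rw [mem_range] at hk
    have h2 := kap_mul_c hℓ (k := k) (by omega)
    have h3 := kap_pos hℓ hκ (k := k) (by omega)
    have h4 := kap_pos hℓ hκ (k := k + 1) (by omega)
    have h5 := b_le hℓ (k := k) (by omega)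
    have h6 := hℓ.c_le (k := k) (by omega)
    unfold pairWeight
    calc _ = G.kap ℓ k * G.b ℓ k * G.u ℓ k θ ^ 2 +
          G.kap ℓ (k + 1) * G.c ℓ (k + 1) * G.u ℓ (k + 1) θ ^ 2 := by rw [← h2]; ring
      _ ≤ G.kap ℓ k * κ * G.u ℓ k θ ^ 2 + G.kap ℓ (k + 1) * κ * G.u ℓ (k + 1) θ ^ 2 := by gcongr
      _ = _ := by rw [hf]; ring
  have h2 : G.christoffelSum ℓ θ = ∑ k ∈ range (offset ℓ (G.g + 1) + 2), f k := by
    rw [christoffelSum, diam_eq]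
  have h3 := sum_range_succ f (offset ℓ (G.g + 1) + 1)
  have h4 := sum_range_succ' f (offset ℓ (G.g + 1) + 1)
  have h5 := hf0 0 (by omega)
  have h6 := hf0 _ le_rfl
  rw [sum_add_distrib, ← mul_sum, ← mul_sum] at h1
  have hκ' : (0 : ℝ) ≤ κ := by positivity
  rw [h2]
  nlinarith [mul_nonneg hκ' h5, mul_nonneg hκ' h6]

/-- The blocks that contribute to `Len` are those with `fa ≤ i < m` or `n ≤ i ≤ fb`, and those that
contribute to `Gap` are those with `m ≤ i < n`. -/
theorem WellPlaced.exists_middle (hI : G.WellPlaced lo hi)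
    (hguide : ∀ i, 1 ≤ i → i ≤ G.g → G.R i ∉ Set.Icc lo hi ∧ G.Lft i ∉ Set.Icc lo hi) :
    ∃ m n, G.fa hi < m ∧ m ≤ n ∧ n ≤ G.fb hi + 1 ∧
      (∀ i, G.fa hi ≤ i → i < m → G.Lft i < lo ∧ hi < G.R i) ∧
      (∀ i, n ≤ i → i < G.fb hi + 1 → G.Lft i < lo ∧ hi < G.R i) ∧
      ∀ ℓ, G.Len ℓ hi = offset ℓ m - offset ℓ (G.fa hi) + (offset ℓ (G.fb hi + 1) - offset ℓ n) ∧
        G.Gap ℓ hi = offset ℓ n - offset ℓ m := by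
  obtain ⟨ha2, hag, -⟩ := hI.fa_mem
  obtain ⟨hb2, hbg, -⟩ := hI.fb_mem
  have hac := hI.fa_lt_fc
  have hcd := G.fc_le_fd hi
  have hab := hI.fa_le_fb
  have hsum : ∀ ℓ, ∀ i j, 1 ≤ i → i ≤ j → ∑ k ∈ Ico i j, ℓ k = offset ℓ j - offset ℓ i :=
    fun ℓ i j h1 h2 => Nat.eq_sub_of_add_eq (sum_Ico_add_offset ℓ h1 h2)
  by_cases hc : G.fc hi ≤ G.g
  · have hdb := fd_le_fb hc
    -- The shift by 1 turns the closed range fc ≤ i ≤ fd into m ≤ i < n.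
    refine ⟨G.fc hi, G.fd hi + 1, hac, by omega, by omega, fun i h1 h2 => ?_, fun i h1 h2 => ?_,
      fun ℓ => ⟨?_, ?_⟩⟩
    · exact ⟨Lft_lt_of_lt_fc_or_fd_lt hguide (by omega) (by omega) (Or.inl h2), hI.lt_R h1 (by omega)⟩
    · exact ⟨Lft_lt_of_lt_fc_or_fd_lt hguide (by omega) (by omega) (Or.inr h1),
        hI.lt_R (by omega) (by omega)⟩
    · have h1 : G.lenSet hi = Ico (G.fa hi) (G.fc hi) ∪ Ico (G.fd hi + 1) (G.fb hi + 1) := by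
        ext i
        simp only [lenSet, if_pos hc, mem_filter, mem_Icc, mem_union, mem_Ico]
        omega
      have h2 : Disjoint (Ico (G.fa hi) (G.fc hi)) (Ico (G.fd hi + 1) (G.fb hi + 1)) := by
        rw [Finset.disjoint_left]
        intro k hk hk'
        rw [mem_Ico] at hk hk'
        omega
      rw [Len, h1, sum_union h2, hsum _ _ _ (by omega) hac.le, hsum _ _ _ (by omega) (by omega)]
    · rw [Gap, if_pos hc, ← hsum _ _ _ (by omega) (by omega)]
      rfl
  · have hc' : G.fc hi = G.g + 1 := (G.fc_mem hi).resolve_left (by omega)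
    -- Without a gap, m = n is placed at the end of the middle range.
    refine ⟨G.fb hi + 1, G.fb hi + 1, by omega, le_rfl, le_rfl, fun i h1 h2 => ?_, fun i h1 h2 => ?_,
      fun ℓ => ⟨?_, ?_⟩⟩
    · exact ⟨Lft_lt_of_lt_fc_or_fd_lt hguide (by omega) (by omega) (Or.inl (by omega)),
        hI.lt_R h1 (by omega)⟩
    · omega
    · have h1 : G.lenSet hi = Ico (G.fa hi) (G.fb hi + 1) := by
        ext i
        simp only [lenSet, if_neg hc, mem_filter, mem_Icc, mem_Ico]
        omega
      rw [Len, h1, hsum _ _ _ (by omega) (by omega)]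
      simp
    · simp [Gap, hc]

/-- The estimates at one point `θ`, with explicit constants. -/
theorem christoffelSum_bounds (hκ : 0 < κ) (hℓ : G.Lengths ℓ) (hη : 0 < η) (hlo : 0 < lo)
    (hθlo : lo ≤ θ) (hθ : θ < κ) {a m n B : ℕ} (ha : 2 ≤ a) (ham : a < m) (hmn : m ≤ n)
    (hnb : n ≤ B + 1) (hb : B ≤ G.g)
    (hhead : ∀ i, 1 ≤ i → i < a → G.RealBlock η θ i ∧ (G.γ i : ℝ) < G.β i)
    (h1 : ∀ i, a ≤ i → i < m → G.ComplexBlock η θ i)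
    (h2 : ∀ i, n ≤ i → i < B + 1 → G.ComplexBlock η θ i)
    (htail : ∀ i, B < i → i ≤ G.g → G.RealBlock η θ i ∧ (G.β i : ℝ) < G.γ i) :
    let M := (1 + 16 * (κ : ℝ) ^ 2 / η) ^ G.g
    let q := growth κ η
    let K := (9 * (κ : ℝ) ^ 4) ^ (offset ℓ n - offset ℓ m)
    let len : ℝ := ((offset ℓ m - offset ℓ a + (offset ℓ (B + 1) - offset ℓ n) : ℕ) : ℝ)
    let P := ∏ i ∈ Ico 1 a, ((G.β i : ℝ) / G.γ i * G.rho i θ ^ 2) ^ ℓ i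
    len * P * (lo ^ 2 / κ) ≤ M ^ 2 * K * (2 * κ * G.christoffelSum ℓ θ) ∧
    (θ ∈ G.eigenvalues ℓ ∨ B = G.g → G.christoffelSum ℓ θ ≤
      (κ / lo ^ 2 + 1 / (q - 1) + 2 + (κ + κ / (q - 1))) *
        (len * (M ^ 2 * K) * ((κ + 1) * (P * κ / ((1 - 1 / q) ^ 2) ^ G.g)))) := by
  intro M q K len P
  have hκ' : (0 : ℝ) < κ := by positivity
  have hκ1 : (1 : ℝ) ≤ κ := by exact_mod_cast hκ
  have hθ0 : 0 < θ := hlo.trans_le hθlo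
  have hs := G.isSolution_u hℓ hκ θ
  set p : ℕ → ℝ := fun k => G.kap ℓ (k + 1) * G.c ℓ (k + 1) with hp
  set u : ℕ → ℝ := fun k => G.u ℓ k θ with hu
  have hu0 : u 0 = 1 := u_zero θ
  have hu1 : u 1 = θ / κ := u_one θ
  have hp0 : p 0 = κ := by
    have := kap_mul_c hℓ (k := 0) (Nat.zero_le _)
    simpa [hp, kap_zero, b] using this
  have hU0 : p 0 * u 1 ^ 2 = θ ^ 2 / κ := by
    rw [hp0, hu1]
    field_simp
  have hU0lo : lo ^ 2 / κ ≤ p 0 * u 1 ^ 2 := by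
    rw [hU0]
    gcongr
  have hU0hi : p 0 * u 1 ^ 2 ≤ κ := by
    rw [hU0, div_le_iff₀ hκ']
    nlinarith
  have hq : 1 < q := one_lt_growth hκ hη
  have hug : 0 < u 0 := by rw [hu0]; exact one_pos
  have hug1 : θ / κ * u 0 ≤ u 1 := by rw [hu0, hu1, mul_one]
  have hag : a ≤ G.g := by omega
  have hat := offset_mono ℓ (show a ≤ G.g + 1 by omega)
  have hbt := offset_mono ℓ (show B + 1 ≤ G.g + 1 by omega)
  have ham' : offset ℓ a < offset ℓ m := by
    have h3 := offset_mono ℓ (show a + 1 ≤ m by omega)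
    rw [offset_succ _ (by omega)] at h3
    have := hℓ.pos a (by omega) (by omega)
    omega
  set N := pairWeight p u (offset ℓ a) with hN
  have hN0 : 0 ≤ N := hs.pairWeight_nonneg hat
  have hM : 1 ≤ M := one_le_pow₀ (le_add_of_nonneg_right (by positivity))
  have hK9 : 2 ≤ 9 * (κ : ℝ) ^ 4 := by
    have : 1 ≤ (κ : ℝ) ^ 4 := one_le_pow₀ hκ1
    linarith
  have hmid := fun k => middle_estimates hκ hθ0.le hθ hs hη (by omega) ham.le hmn hnb
    (by omega) h1 h2 (k := k)
  obtain ⟨hlow, hupp⟩ := middle_sum_bounds ham' (offset_mono ℓ hmn) (offset_mono ℓ hnb) hbt hM hK9 hN0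
    (fun k hk => hs.pairWeight_nonneg hk) (fun k => (hmid k).1) (fun k => (hmid k).2.1)
    (fun k => (hmid k).2.2)
  have hUN : p (offset ℓ a) * u (offset ℓ a + 1) ^ 2 ≤ N := hs.mul_sq_le_pairWeight hat
  have hP0 : 0 ≤ P := prod_nonneg fun i _ => by positivity
  have hlen1 : 1 ≤ len := by
    exact Nat.one_le_cast.2 (show 1 ≤ offset ℓ m - offset ℓ a + (offset ℓ (B + 1) - offset ℓ n) by omega)
  have hK1 : 1 ≤ K := one_le_pow₀ (by linarith)
  have hMK1 : 1 ≤ M ^ 2 * K := one_le_mul_of_one_le_of_one_le (one_le_pow₀ hM) hK1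
  refine ⟨?_, fun hlast => ?_⟩
  · have h3 := head_prod_le hη hκ hθ hag hhead hs hug hug1 (by omega)
    calc len * P * (lo ^ 2 / κ) ≤ len * (P * (p 0 * u 1 ^ 2)) := by
          rw [mul_assoc]
          gcongr
      _ ≤ len * N := mul_le_mul_of_nonneg_left (h3.trans hUN) (by positivity)
      _ ≤ M ^ 2 * K * ∑ k ∈ range (offset ℓ (G.g + 1) + 1), pairWeight p u k := hlow
      _ ≤ _ := mul_le_mul_of_nonneg_left (sum_pairWeight_le hℓ hκ θ) (by positivity)
  · set r := ((1 - 1 / q) ^ 2) ^ G.g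
    have hr : 0 < r := by
      have : 0 < 1 - 1 / q := by
        rw [sub_pos, div_lt_one (by linarith)]
        exact hq
      positivity
    have hNP : N ≤ (κ + 1) * (P * κ / r) := by
      refine (head_pair_le hη hκ hθ hag hhead hs hug hug1 ha).trans ?_
      gcongr
      rw [le_div_iff₀ hr, mul_comm]
      exact (le_head_prod hη hκ hθ hag hhead hs hug hug1 (by omega)).trans (by gcongr)
    -- The term κ_0 u_0² = 1 is charged to N, which is at least p_0 u_1² = θ² / κ ≥ lo² / κ.
    have hone : 1 ≤ κ / lo ^ 2 * N := by
      have h3 := hU0lo.trans ((head_mono hη hκ hθ hag hhead hs hug hug1).trans hUN)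
      calc (1 : ℝ) = κ / lo ^ 2 * (lo ^ 2 / κ) := by field_simp
        _ ≤ _ := by gcongr
    have hheadsum : ∑ k ∈ Ico 0 (offset ℓ a), p k * u (k + 1) ^ 2 ≤ 1 / (q - 1) * N := by
      rw [one_div, inv_mul_eq_div, le_div_iff₀ (by linarith), mul_comm]
      exact (head_sum_le hη hκ hθ hag hhead hs hug hug1).trans hUN
    have hmidsum : ∑ k ∈ Ico (offset ℓ a) (offset ℓ (B + 1)), p k * u (k + 1) ^ 2 ≤
        2 * len * (M ^ 2 * K) * N := by
      refine le_trans (sum_le_sum fun k hk => ?_) hupp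
      rw [mem_Ico] at hk
      exact hs.mul_sq_le_pairWeight (by omega)
    have htailsum := tail_sum_le_pairWeight hη hκ hθ (by omega) hb htail hs
      (hlast.imp_left fun h => last_row_of_mem_eigenvalues hℓ hκ h)
    have hNb : pairWeight p u (offset ℓ (B + 1)) ≤ M ^ 2 * K * N :=
      ((hmid _).2.2 (offset_mono ℓ hnb) le_rfl).1
    set X := len * (M ^ 2 * K) * N with hX
    have hNX : N ≤ X := le_mul_of_one_le_left hN0 (one_le_mul_of_one_le_of_one_le hlen1 hMK1)
    have hbX : M ^ 2 * K * N ≤ X := by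
      calc M ^ 2 * K * N ≤ len * (M ^ 2 * K * N) := le_mul_of_one_le_left (by positivity) hlen1
        _ = X := by rw [hX]; ring
    have hq1 : 0 < q - 1 := by linarith
    have hS := christoffelSum_le hℓ hκ θ
    rw [range_eq_Ico, ← sum_Ico_consecutive _ (Nat.zero_le (offset ℓ a)) (show offset ℓ a ≤ _ by omega),
      ← sum_Ico_consecutive _ (offset_mono ℓ (show a ≤ B + 1 by omega)) (show offset ℓ (B + 1) ≤ _ by omega)] at hS
    -- The four summands bound the term of index 0, the head, the middle and the tail.
    calc G.christoffelSum ℓ θ ≤ κ / lo ^ 2 * X + (1 / (q - 1) * X + (2 * X + (κ + κ / (q - 1)) * X)) := by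
          refine hS.trans (add_le_add ?_ (add_le_add ?_ (add_le_add ?_ ?_)))
          · exact hone.trans (by gcongr)
          · exact hheadsum.trans (by gcongr)
          · exact hmidsum.trans (le_of_eq (by rw [hX]; ring))
          · exact htailsum.trans (by gcongr; exact hNb.trans hbX)
      _ = (κ / lo ^ 2 + 1 / (q - 1) + 2 + (κ + κ / (q - 1))) * X := by ring
      _ ≤ _ := mul_le_mul_of_nonneg_left (mul_le_mul_of_nonneg_left hNP (by positivity))
        (by positivity)

end GraphicalSeq

end

/-! ### The theorem: choice of constants -/

theorem mainTheorem4 (κ lam : ℕ) (hκ : 3 ≤ κ) (hlam : lam + 2 ≤ κ)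
    (G : GraphicalSeq κ lam) (lo hi : ℝ) (hI : G.WellPlaced lo hi)
    (hguide : ∀ i, 1 ≤ i → i ≤ G.g → G.R i ∉ Set.Icc lo hi ∧ G.Lft i ∉ Set.Icc lo hi) :
    ∃ C₁ : ℝ, 0 < C₁ ∧
      ∀ (Δ : Finset ℕ) (L : ℕ → ℕ), Set.Icc lo hi ∩ G.badSet Δ L = ∅ →
        ∃ F C₂ : ℝ, 0 < F ∧ 0 < C₂ ∧
          ∀ ℓ : ℕ → ℕ, G.IsQuadruple Δ L ℓ → (∀ i ∈ Δ, F < (ℓ i : ℝ)) →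
            ∀ θ ∈ Set.Icc lo hi,
              C₁ * (1 / (9 * (κ : ℝ) ^ 4)) ^ G.Gap ℓ hi * (G.Len ℓ hi : ℝ) * G.headProd ℓ hi θ
                  ≤ G.christoffelSum ℓ θ ∧
              (θ ∈ G.eigenvalues ℓ ∨ G.fb hi = G.g →
                G.christoffelSum ℓ θ ≤
                  C₂ * (9 * (κ : ℝ) ^ 4) ^ G.Gap ℓ hi * (G.Len ℓ hi : ℝ) *
                    G.headProd ℓ hi θ) := by
  have hκ0 : 0 < κ := by omega
  have hκ' : (0 : ℝ) < κ := by positivity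
  obtain ⟨η, hη, hdisc⟩ := G.exists_discr_bound lo hi
  obtain ⟨m, n, ham, hmn, hnb, h1, h2, hlen⟩ := hI.exists_middle hguide
  obtain ⟨ha2, hag, haR⟩ := hI.fa_mem
  obtain ⟨hb2, hbg, -⟩ := hI.fb_mem
  have hlo := hI.lo_pos
  set M : ℝ := (1 + 16 * (κ : ℝ) ^ 2 / η) ^ G.g with hM
  have hM0 : 0 < M := by positivity
  set q := GraphicalSeq.growth κ η
  have hq : 1 < q := GraphicalSeq.one_lt_growth hκ0 hη
  set r := ((1 - 1 / q) ^ 2) ^ G.g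
  have hr : 0 < r := by
    have : 0 < 1 - 1 / q := by
      rw [sub_pos, div_lt_one (by linarith)]
      exact hq
    positivity
  have hq1 : 0 < q - 1 := by linarith
  -- C₁ and C₂ are read off from `christoffelSum_bounds`; they involve only κ, g, `lo` and η. The
  -- estimates there hold for all positive block lengths, so 1 serves as F.
  refine ⟨lo ^ 2 / κ / (M ^ 2 * (2 * κ)), by positivity, fun Δ L _ => ⟨1,
    (κ / lo ^ 2 + 1 / (q - 1) + 2 + (κ + κ / (q - 1))) * (M ^ 2 * ((κ + 1) * (κ / r))),
    one_pos, by positivity, fun ℓ hquad _ θ hθ => ?_⟩⟩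
  have hθκ : θ < κ := hθ.2.trans_lt (haR.trans_le (G.R_le (by omega) hag))
  have hreal : ∀ i, 1 ≤ i → i ≤ G.g → G.R i < lo → G.RealBlock η θ i := fun i hi1 hig hR =>
    ⟨by linarith [G.α_le_R i, hθ.1], (hdisc i hi1 hig θ hθ).1 hR⟩
  have hb := GraphicalSeq.christoffelSum_bounds hκ0 hquad.lengths hη hlo hθ.1 hθκ ha2 ham hmn hnb hbg
    (fun i hi1 hia => have h := hI.head hguide hi1 hia
      ⟨hreal i hi1 (by omega) h.1, h.2⟩)
    (fun i hi1 him => (hdisc i (by omega) (by omega) θ hθ).2 (h1 i hi1 him).1 (h1 i hi1 him).2)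
    (fun i hi1 him => (hdisc i (by omega) (by omega) θ hθ).2 (h2 i hi1 him).1 (h2 i hi1 him).2)
    (fun i hi1 hig => have h := hI.tail hguide hi1 hig
      ⟨hreal i (by omega) hig h.1, h.2⟩)
  simp only [← (hlen ℓ).1, ← (hlen ℓ).2] at hb
  obtain ⟨hb1, hb2⟩ := hb
  refine ⟨?_, fun hlast => (hb2 hlast).trans (le_of_eq ?_)⟩
  · have hK : 0 < (9 * (κ : ℝ) ^ 4) ^ G.Gap ℓ hi := by positivity
    have h3 : lo ^ 2 / κ / (M ^ 2 * (2 * κ)) * (1 / (9 * (κ : ℝ) ^ 4)) ^ G.Gap ℓ hi * (G.Len ℓ hi : ℝ) *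
        G.headProd ℓ hi θ = (G.Len ℓ hi : ℝ) * G.headProd ℓ hi θ * (lo ^ 2 / κ) /
          (M ^ 2 * (9 * (κ : ℝ) ^ 4) ^ G.Gap ℓ hi * (2 * κ)) := by
      rw [one_div_pow]
      field_simp
    rw [h3, div_le_iff₀ (by positivity)]
    refine hb1.trans (le_of_eq ?_)
    ring
  · rw [GraphicalSeq.headProd]
    ring
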